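/- Let $\lambda=(\lambda_1>\lambda_2>\cdots>\lambda_r\ge 0)$ be a strict partition with an even number $r$ of parts (a zero part is allowed), with shifted diagram $SD(\lambda)=\{(i,j)\in\mathbb Z^2 : 1\le i\le r,\ i\le j\le \lambda_i+i-1\}$. A shifted tableau of shape $\lambda$ over a set $X$ is a map $(t_{ij}) : SD(\lambda)\to X$. Let $QSST(\lambda)$ be the set of shifted tableaux $M=(m_{ij})$ of shape $\lambda$ over the ordered alphabet $1'<1<2'<2<\cdots$ such that the entries increase weakly along rows and columns, each $k'$ occurs at most once in every row, and each unmarked $k$ occurs at most once in every column. For a shifted tableau $\boldsymbol s=(s_{ij})$ of shape $\lambda$ over $\mathbb C$ put $$\zeta^Q_\lambda(\boldsymbol s)=\sum_{M\in QSST(\lambda)}\frac1{M^{\boldsymbol s}},\qquad M^{\boldsymbol s}=\prod_{(i,j)\in SD(\lambda)}|m_{ij}|^{s_{ij}},\qquad |k|=|k'|=k .$$ Suppose that $\boldsymbol s$ is constant along diagonals, that is, $s_{ij}=s_{1k}$ whenever $j-i=k-1$. For $1\le i<j\le r$ let $\boldsymbol s_{(\lambda_i,\lambda_j)}$ be the shifted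 tableau of shape $(\lambda_i,\lambda_j)$ with first row $s_{ii},\dots,s_{i,\,i+\lambda_i-1}$ and second row $s_{jj},\dots,s_{j,\,j+\lambda_j-1}$. (a) If $\Re(s_{ij})\ge 1$ for all $(i,j)\in SD(\lambda)$ and $\Re(s_{i,\,i+\lambda_i-1})>1$ for all $i$ with $\lambda_i>0$, then the series of all $\zeta^Q_{(\lambda_i,\lambda_j)}(\boldsymbol s_{(\lambda_i,\lambda_j)})$, $1\le i<j\le r$, converge absolutely. (b) Whenever the series of all $\zeta^Q_{(\lambda_i,\lambda_j)}(\boldsymbol s_{(\lambda_i,\lambda_j)})$, $1\le i<j\le r$, converge absolutely, the series of $\zeta^Q_\lambda(\boldsymbol s)$ converges absolutely, and $$\zeta^Q_\lambda(\boldsymbol s)=\mathrm{pf}(M_\lambda),$$ where $M_\lambda=(a_{ij})$ is the $r\times r$ upper triangular matrix with $a_{ij}=\zeta^Q_{(\lambda_i,\lambda_j)}(\boldsymbol s_{(\lambda_i,\lambda_j)})$ for $i<j$ and $a_{ij}=0$ for $i\ge j$. Here, with $r=2n$, $$\mathrm{pf}(A)=\sum_{\pi}\mathrm{sgn}(\pi)\prod_{i=1}^{n}a_{\pi(2i-1),\pi(2i)},$$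 the sum being over all permutations $\pi$ of $\{1,\dots,2n\}$ with $\pi(1)<\pi(3)<\cdots<\pi(2n-1)$ and $\pi(2i-1)<\pi(2i)$ for $1\le i\le n$. -/

import Mathlib

/-- The boxes of the shifted diagram of `lam = (lam 0, …, lam (r - 1))`, rows and columns numbered
from `0`: row `i` has `lam i` boxes and starts on the main diagonal, so that the pair `⟨i, c⟩` with
`c < lam i` is the box in row `i` and column `i + c`. -/
abbrev ShiftedBox {r : ℕ} (lam : Fin r → ℕ) : Type := (i : Fin r) × Fin (lam i)

namespace ShiftedBox

variable {r : ℕ} {lam : Fin r → ℕ}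

/-- The row of a box. -/
def row (b : ShiftedBox lam) : ℕ := b.1

/-- The column of a box. -/
def col (b : ShiftedBox lam) : ℕ := b.1 + b.2

end ShiftedBox

/-- `ST(lam, X)`: the shifted tableaux of shape `lam` over `X`. -/
abbrev ShiftedTableau {r : ℕ} (lam : Fin r → ℕ) (X : Type*) : Type _ := ShiftedBox lam → X

/-- `ST^diag(lam, X)`: the entry at a box `b` is the entry at the box of the first row that
lies on the same diagonal as `b`. -/
def ShiftedTableau.IsDiag {r : ℕ} {lam : Fin r → ℕ} {X : Type*} (t : ShiftedTableau lam X) :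
    Prop :=
  ∀ b b₁ : ShiftedBox lam, b₁.row = 0 → b.col - b.row = b₁.col - b₁.row → t b = t b₁

/-- The filling of the shifted diagram of shape `(lam i, lam j)` whose two rows are row `i`
and row `j` of `t`. -/
def ShiftedTableau.twoRows {r : ℕ} {lam : Fin r → ℕ} {X : Type*} (t : ShiftedTableau lam X)
    (i j : Fin r) : ShiftedTableau (lam ∘ ![i, j]) X :=
  fun b => t ⟨![i, j] b.1, b.2⟩

/-- The marked letters `1' < 1 < 2' < 2 < ⋯`: the pair `(k, false)` is `k'` and the pair
`(k, true)` is `k`, ordered lexicographically. -/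
abbrev MarkedLetter : Type := ℕ+ ×ₗ Bool

namespace MarkedLetter

/-- The absolute value `|k| = |k'| = k`. -/
def abs (x : MarkedLetter) : ℕ := (ofLex x).1

/-- The letter is of the form `k'`. -/
def IsMarked (x : MarkedLetter) : Prop := (ofLex x).2 = false

end MarkedLetter

/-- Semi-standard marked shifted tableaux, with marks allowed on the main diagonal. -/
structure IsQSST {r : ℕ} {lam : Fin r → ℕ} (m : ShiftedTableau lam MarkedLetter) : Prop where
  row_weak : ∀ b b' : ShiftedBox lam, b.row = b'.row → b.col ≤ b'.col → m b ≤ m b'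
  col_weak : ∀ b b' : ShiftedBox lam, b.col = b'.col → b.row ≤ b'.row → m b ≤ m b'
  /-- each `k'` occurs at most once in each row -/
  marked_row : ∀ b b' : ShiftedBox lam,
    b.row = b'.row → m b = m b' → (m b).IsMarked → b = b'
  /-- each unmarked `k` occurs at most once in each column -/
  unmarked_col : ∀ b b' : ShiftedBox lam,
    b.col = b'.col → m b = m b' → ¬ (m b).IsMarked → b = b'

/-- The set `QSST(lam)`. -/
def QSST {r : ℕ} (lam : Fin r → ℕ) : Set (ShiftedTableau lam MarkedLetter) :=
  {m | IsQSST m}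

/-- The summand `1 / M^s`, where `M^s = ∏ |m_b| ^ s_b` over all boxes `b`. -/
noncomputable def schurQTerm {r : ℕ} {lam : Fin r → ℕ} (s : ShiftedTableau lam ℂ)
    (m : QSST lam) : ℂ :=
  1 / ∏ b : ShiftedBox lam, ((m.1 b).abs : ℂ) ^ s b

/-- The Schur `Q`-multiple zeta function `ζ^Q_lam(s)`. -/
noncomputable def schurQZeta {r : ℕ} {lam : Fin r → ℕ} (s : ShiftedTableau lam ℂ) : ℂ :=
  ∑' m : QSST lam, schurQTerm s m

/-- The position `2 i` in `0, …, 2 n - 1` (the odd position `2 i - 1` when counting from `1`). -/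
def pairFst {n : ℕ} (i : Fin n) : Fin (2 * n) := ⟨2 * i, by omega⟩

/-- The position `2 i + 1` in `0, …, 2 n - 1`. -/
def pairSnd {n : ℕ} (i : Fin n) : Fin (2 * n) := ⟨2 * i + 1, by omega⟩

/-- The permutations `π` with `π(1) < π(3) < ⋯ < π(2n-1)` and `π(2i-1) < π(2i)` for all `i`
(counting from `1`). -/
def pfaffianPerms (n : ℕ) : Finset (Equiv.Perm (Fin (2 * n))) :=
  {π | (∀ i j : Fin n, i < j → π (pairFst i) < π (pairFst j)) ∧
    ∀ i : Fin n, π (pairFst i) < π (pairSnd i)}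

/-- The pfaffian of an upper triangular (or antisymmetric) matrix. -/
def pfaffian {n : ℕ} {R : Type*} [CommRing R] (A : Matrix (Fin (2 * n)) (Fin (2 * n)) R) : R :=
  ∑ π ∈ pfaffianPerms n,
    ((Equiv.Perm.sign π : ℤ) : R) * ∏ i : Fin n, A (π (pairFst i)) (π (pairSnd i))

/-- The upper triangular matrix `M_lam` with entries `ζ^Q_{(lam i, lam j)}(s_{(lam i, lam j)})`
for `i < j`, and `0` on and below the diagonal. -/
noncomputable def schurQMatrix {r : ℕ} {lam : Fin r → ℕ} (s : ShiftedTableau lam ℂ) :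
    Matrix (Fin r) (Fin r) ℂ :=
  Matrix.of fun i j => if i < j then schurQZeta (s.twoRows i j) else 0

/-! Number the diagonals by `c`, so that row `i` meets diagonal `c` in the box `⟨i, c⟩`. Constancy
of the exponents along diagonals makes the weight of an entry independent of its row, and a tableau
becomes a path of diagonals. Given the next diagonal `l`, the entry `k i` must be row-compatible
with `l i` and column-compatible with `l (i - 1)`; no two entries of the same diagonal are compared
directly.

For strictly increasing `l`, row-compatibility with `l (i - 1)` implies it with `l i`. Hence the
indicator of both conditions is the difference of the row indicators for `i` and `i - 1`. Summed
against a function antisymmetric in the rows, this subtraction is an invisible row operation, so all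
column conditions may be dropped (`sum_rowKernel_eq_sum_diagKernel`). Antisymmetry survives a
transfer step, and finished rows rest at distinct boundary letters above all entries, which keeps
diagonals strictly increasing. By induction on the diagonals (`sum_paths_eq_sum_rowGF`) the tableau
sum becomes a sum over first-column words `k` of independent row generating functions times `S k`,
for any antisymmetric `S` equal to 1 on increasing words (`sum_boundedQSST_eq`).

Take `S k` to be the pfaffian of the signs of `k b - k a`. Multilinearity (`pfaffian_sum_eq`) pulls
this pfaffian out of the sum, and each entry is the same identity for two rows, where `S` is the
sign of one pair. This proves the pfaffian formula for entries bounded by `N`, over any commutative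
domain of characteristic zero. Applied to the norms of the weights, it bounds the partial sums and
gives absolute convergence; applied to the weights themselves, it gives the formula as `N → ∞`.

For (a), the surplus of the exponent at the largest entry of a row is shared among the whole row,
which leaves a product of convergent one-variable series. -/

/-- The relation between horizontally adjacent entries of a marked shifted tableau. The relation
between vertically adjacent entries `x` above `y` is `¬ RowRel marked y x`. -/
def RowRel {Y : Type*} [LinearOrder Y] (marked : Y → Prop) (x y : Y) : Prop :=
  x < y ∨ x = y ∧ ¬ marked x

/-! ### Row and column relations between marked letters -/

section RowRel

variable {Y : Type*} [LinearOrder Y] {marked : Y → Prop} {x y z : Y}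

theorem RowRel.le (h : RowRel marked x y) : x ≤ y := by
  rcases h with h | h
  · exact h.le
  · exact h.1.le

theorem RowRel.trans_lt (h : RowRel marked x y) (h' : y < z) : RowRel marked x z :=
  Or.inl (h.le.trans_lt h')

theorem RowRel.trans (h : RowRel marked x y) (h' : RowRel marked y z) : RowRel marked x z := by
  rcases h with h | ⟨rfl, h⟩
  · exact Or.inl (h.trans_le h'.le)
  · exact h'

theorem not_rowRel_iff : ¬ RowRel marked y x ↔ x < y ∨ x = y ∧ marked x := by
  unfold RowRel
  constructor
  · intro h
    push Not at h
    rcases h.1.lt_or_eq with h1 | h1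
    · exact Or.inl h1
    · exact Or.inr ⟨h1, h1 ▸ h.2 h1.symm⟩
  · rintro (h | ⟨rfl, h⟩) (h' | ⟨h', h''⟩)
    · exact lt_asymm h h'
    · exact h.ne' h'
    · exact lt_irrefl _ h'
    · exact h'' h

/-- Here `x` is left of `y` and `z` is below `y`, so `x` and `z` are consecutive on a diagonal. They
differ because equality throughout would make `y` both unmarked and marked. -/
theorem lt_of_rowRel_of_not_rowRel (h : RowRel marked x y) (h' : ¬ RowRel marked z y) :
    x < z := by
  rw [not_rowRel_iff] at h'
  rcases h with h | ⟨rfl, h⟩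
  · rcases h' with h' | ⟨rfl, h'⟩
    · exact h.trans h'
    · exact h
  · rcases h' with h' | ⟨rfl, h'⟩
    · exact h'
    · exact absurd h' h

theorem not_rowRel_trans (h : ¬ RowRel marked y x) (h' : ¬ RowRel marked z y) :
    ¬ RowRel marked z x := by
  rw [not_rowRel_iff] at *
  rcases h with h | ⟨rfl, h⟩
  · rcases h' with h' | ⟨rfl, h'⟩
    · exact Or.inl (h.trans h')
    · exact Or.inl h
  · exact h'

end RowRel

/-! ### Transfer between diagonals and removal of the column conditions -/

/-- The product of a family of functions may be changed by subtracting one factor from another one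
under the sum against an antisymmetric function. -/
theorem sum_prod_mul_eq_of_sub_eq {ι Y R : Type*} [Fintype ι] [DecidableEq ι] [Fintype Y]
    [CommRing R] [NoZeroDivisors R] [CharZero R] {F F' : ι → Y → R} {S : (ι → Y) → R} {i j : ι}
    (hij : i ≠ j) (hS : ∀ k, S (k ∘ Equiv.swap i j) = - S k)
    (h : ∀ m, m ≠ i → F m = F' m) (hi : ∀ y, F i y - F' i y = F j y) :
    ∑ k : ι → Y, (∏ m, F m (k m)) * S k = ∑ k : ι → Y, (∏ m, F' m (k m)) * S k := by
  -- The difference of the two products has equal factors at `i` and `j`, so it is symmetric under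
  -- their exchange and pairs to zero with `S`.
  set G : ι → Y → R := Function.update F i (F j) with hG
  have hdiff : ∀ k : ι → Y, (∏ m, F m (k m)) - ∏ m, F' m (k m) = ∏ m, G m (k m) := by
    intro k
    rw [← Finset.mul_prod_erase _ _ (Finset.mem_univ i),
      ← Finset.mul_prod_erase Finset.univ (fun m => F' m (k m)) (Finset.mem_univ i),
      ← Finset.mul_prod_erase Finset.univ (fun m => G m (k m)) (Finset.mem_univ i)]
    have h1 : ∏ m ∈ Finset.univ.erase i, F' m (k m) = ∏ m ∈ Finset.univ.erase i, F m (k m) :=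
      Finset.prod_congr rfl fun m hm => by rw [h m (Finset.ne_of_mem_erase hm)]
    have h2 : ∏ m ∈ Finset.univ.erase i, G m (k m) = ∏ m ∈ Finset.univ.erase i, F m (k m) :=
      Finset.prod_congr rfl fun m hm => by
        rw [hG, Function.update_of_ne (Finset.ne_of_mem_erase hm)]
    rw [h1, h2, ← sub_mul, hi, hG, Function.update_self]
  have hGs : ∀ m, G (Equiv.swap i j m) = G m := by
    intro m
    by_cases h1 : m = i
    · subst h1
      rw [Equiv.swap_apply_left, hG, Function.update_self, Function.update_of_ne hij.symm]
    by_cases h2 : m = j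
    · subst h2
      rw [Equiv.swap_apply_right, hG, Function.update_self, Function.update_of_ne hij.symm]
    rw [Equiv.swap_apply_of_ne_of_ne h1 h2]
  have hprod : ∀ k : ι → Y,
      ∏ m, G m ((k ∘ Equiv.swap i j) m) = ∏ m, G m (k m) := by
    intro k
    rw [← Equiv.prod_comp (Equiv.swap i j) fun m => G m (k m)]
    exact Finset.prod_congr rfl fun m _ => by rw [hGs]; rfl
  rw [← sub_eq_zero, ← Finset.sum_sub_distrib]
  simp_rw [← sub_mul, hdiff]
  have hz : ∑ k : ι → Y, (∏ m, G m (k m)) * S k = - ∑ k : ι → Y, (∏ m, G m (k m)) * S k := by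
    rw [← Finset.sum_neg_distrib]
    refine (Equiv.sum_comp (Equiv.arrowCongr (Equiv.swap i j) (Equiv.refl Y)) _).symm.trans
      (Finset.sum_congr rfl fun k _ => ?_)
    have : (Equiv.arrowCongr (Equiv.swap i j) (Equiv.refl Y)) k = k ∘ Equiv.swap i j := by
      funext m
      simp [Equiv.arrowCongr]
    rw [this, hprod, hS]
    ring
  exact self_eq_neg.mp hz

open Classical in
/-- The transfer weight of one row of remaining length `a` from the entry `k` to the next entry
`l`. A row of length `0` rests at the boundary letter `t`. -/
noncomputable def rowKernel {Y R : Type*} [LinearOrder Y] [CommRing R] (marked : Y → Prop)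
    (X : Set Y) (w : Y → R) (a : ℕ) (t : Y) (l k : Y) : R :=
  if a = 0 then (if k = t then 1 else 0) else if k ∈ X ∧ RowRel marked k l then w k else 0

/-- The admissible entries on row `i` of a diagonal that precedes the diagonal `l`. -/
def DiagValid {Y : Type*} [LinearOrder Y] {r : ℕ} (marked : Y → Prop) (X : Set Y)
    (lam : Fin r → ℕ) (top : Fin r → Y) (i : Fin r) (l : Fin r → Y) (k : Y) : Prop :=
  if lam i = 0 then k = top i else
    k ∈ X ∧ RowRel marked k (l i) ∧ ∀ j : Fin r, (j : ℕ) + 1 = i → ¬ RowRel marked k (l j)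

open Classical in
/-- The transfer weight from row `i` of a diagonal of a tableau to the next diagonal `l`. -/
noncomputable def diagKernel {Y R : Type*} [LinearOrder Y] [CommRing R] {r : ℕ}
    (marked : Y → Prop) (X : Set Y) (w : Y → R) (lam : Fin r → ℕ) (top : Fin r → Y) (i : Fin r)
    (l : Fin r → Y) (k : Y) : R :=
  if DiagValid marked X lam top i l k then (if lam i = 0 then 1 else w k) else 0

section Kernels

variable {Y R : Type*} [LinearOrder Y] [CommRing R] {r : ℕ} {marked : Y → Prop} {X : Set Y}
  {w : Y → R} {lam : Fin r → ℕ} {top : Fin r → Y} {i : Fin r} {l : Fin r → Y} {k : Y}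

theorem diagValid_of_ne_zero (h : lam i ≠ 0) : DiagValid marked X lam top i l k ↔
    k ∈ X ∧ RowRel marked k (l i) ∧ ∀ j : Fin r, (j : ℕ) + 1 = i → ¬ RowRel marked k (l j) := by
  unfold DiagValid
  rw [if_neg h]

theorem diagKernel_of_eq_zero (h : lam i = 0) (t : Y) :
    diagKernel marked X w lam top i l k = rowKernel marked X w (lam i) (top i) t k := by
  have hv : DiagValid marked X lam top i l k ↔ k = top i := by
    unfold DiagValid
    rw [if_pos h]
  unfold diagKernel rowKernel
  rw [if_pos h, if_pos h]
  by_cases hk : k = top i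
  · rw [if_pos hk, if_pos (hv.mpr hk)]
  · rw [if_neg hk, if_neg (mt hv.mp hk)]

theorem diagKernel_of_valid (h : lam i ≠ 0) (hv : DiagValid marked X lam top i l k) :
    diagKernel marked X w lam top i l k = w k := by
  unfold diagKernel
  rw [if_pos hv, if_neg h]

theorem diagKernel_of_not_valid (hv : ¬ DiagValid marked X lam top i l k) :
    diagKernel marked X w lam top i l k = 0 :=
  if_neg hv

open Classical in
theorem rowKernel_of_ne_zero {a : ℕ} {t l : Y} (h : a ≠ 0) :
    rowKernel marked X w a t l k = if k ∈ X ∧ RowRel marked k l then w k else 0 :=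
  if_neg h

theorem rowKernel_of_valid {a : ℕ} {t l : Y} (h : a ≠ 0) (hk : k ∈ X) (hl : RowRel marked k l) :
    rowKernel marked X w a t l k = w k := by
  rw [rowKernel_of_ne_zero h, if_pos ⟨hk, hl⟩]

theorem rowKernel_of_not_valid {a : ℕ} {t l : Y} (h : a ≠ 0)
    (hk : ¬ (k ∈ X ∧ RowRel marked k l)) : rowKernel marked X w a t l k = 0 := by
  rw [rowKernel_of_ne_zero h, if_neg hk]

end Kernels

section Kernels

variable {Y R : Type*} [LinearOrder Y] [Fintype Y] [CommRing R] [NoZeroDivisors R] [CharZero R]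
  {r : ℕ}

/-- One determinant-style row operation per row: the column condition in row `d` is restored by
subtracting the row kernel of row `d - 1`. The shape is strict only among positive lengths, since
truncated shapes have several empty rows. -/
theorem sum_rowKernel_eq_sum_diagKernel (marked : Y → Prop) (X : Set Y) (w : Y → R)
    (lam : Fin r → ℕ) (top : Fin r → Y) (hlam : ∀ i j, i < j → 0 < lam j → lam j < lam i)
    (l : Fin r → Y) (hl : StrictMono l) (S : (Fin r → Y) → R)
    (hS : ∀ i j, i ≠ j → 0 < lam i → 0 < lam j → ∀ k, S (k ∘ Equiv.swap i j) = - S k) :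
    ∑ k : Fin r → Y, (∏ i, rowKernel marked X w (lam i) (top i) (l i) (k i)) * S k =
      ∑ k : Fin r → Y, (∏ i, diagKernel marked X w lam top i l (k i)) * S k := by
  -- Interpolates between the two sides. Row `d - 1` still carries its row kernel when row `d` is
  -- changed.
  set F : ℕ → Fin r → Y → R := fun d i => if (i : ℕ) < d then
    rowKernel marked X w (lam i) (top i) (l i) else diagKernel marked X w lam top i l with hF
  have hstep : ∀ d, ∑ k : Fin r → Y, (∏ i, F d i (k i)) * S k =
      ∑ k : Fin r → Y, (∏ i, F (d + 1) i (k i)) * S k := by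
    intro d
    by_cases hd : d < r
    swap
    · have : F d = F (d + 1) := by
        funext i
        have h1 : (i : ℕ) < d := by omega
        have h2 : (i : ℕ) < d + 1 := by omega
        simp only [hF, if_pos h1, if_pos h2]
      rw [this]
    have hne : ∀ m : Fin r, m ≠ ⟨d, hd⟩ → F (d + 1) m = F d m := by
      intro m hm
      have hm' : (m : ℕ) ≠ d := fun h => hm (Fin.ext h)
      have : (m : ℕ) < d + 1 ↔ (m : ℕ) < d := by omega
      simp only [hF, this]
    have hFd : F d ⟨d, hd⟩ = diagKernel marked X w lam top ⟨d, hd⟩ l := by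
      simp [hF]
    have hFd' : F (d + 1) ⟨d, hd⟩ =
        rowKernel marked X w (lam ⟨d, hd⟩) (top ⟨d, hd⟩) (l ⟨d, hd⟩) := by
      simp [hF]
    by_cases htriv : lam ⟨d, hd⟩ = 0 ∨ d = 0
    · have : F d = F (d + 1) := by
        funext m
        by_cases hm : m = ⟨d, hd⟩
        · subst hm
          rw [hFd, hFd']
          funext y
          by_cases h0 : lam ⟨d, hd⟩ = 0
          · exact diagKernel_of_eq_zero h0 _
          · obtain rfl : d = 0 := htriv.resolve_left h0
            have hv := diagValid_of_ne_zero (marked := marked) (X := X) (top := top) (l := l)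
              (k := y) h0
            by_cases h1 : y ∈ X ∧ RowRel marked y (l ⟨0, hd⟩)
            · rw [diagKernel_of_valid h0 (hv.mpr ⟨h1.1, h1.2, by simp⟩),
                rowKernel_of_valid h0 h1.1 h1.2]
            · rw [diagKernel_of_not_valid fun h => h1 ⟨(hv.mp h).1, (hv.mp h).2.1⟩,
                rowKernel_of_not_valid h0 h1]
        · rw [hne m hm]
      rw [this]
    · push Not at htriv
      obtain ⟨h0, hd0⟩ := htriv
      have hd1 : d - 1 < r := by omega
      have hlt : (⟨d - 1, hd1⟩ : Fin r) < ⟨d, hd⟩ := by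
        rw [Fin.lt_def]; simp only; omega
      have hpos := hlam _ _ hlt (Nat.pos_of_ne_zero h0)
      have h0' : lam ⟨d - 1, hd1⟩ ≠ 0 := by omega
      refine (sum_prod_mul_eq_of_sub_eq (i := ⟨d, hd⟩) (j := ⟨d - 1, hd1⟩) hlt.ne'
        (hS _ _ hlt.ne' (by omega) (by omega)) hne ?_).symm
      intro y
      have hFj : F (d + 1) ⟨d - 1, hd1⟩ =
          rowKernel marked X w (lam ⟨d - 1, hd1⟩) (top ⟨d - 1, hd1⟩) (l ⟨d - 1, hd1⟩) := by
        have : d - 1 < d + 1 := by omega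
        simp [hF, this]
      rw [hFd, hFd', hFj]
      have hall : (∀ j : Fin r, (j : ℕ) + 1 = d → ¬ RowRel marked y (l j)) ↔
          ¬ RowRel marked y (l ⟨d - 1, hd1⟩) := by
        constructor
        · intro h
          exact h _ (by simp only; omega)
        · intro h j hj
          have : j = ⟨d - 1, hd1⟩ := Fin.ext (by simp only; omega)
          rwa [this]
      -- This nesting of the conditions is where strict increase of `l` enters.
      have himp : RowRel marked y (l ⟨d - 1, hd1⟩) → RowRel marked y (l ⟨d, hd⟩) :=
        fun h => h.trans_lt (hl hlt)
      have hv := diagValid_of_ne_zero (marked := marked) (X := X) (top := top) (l := l)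
        (k := y) h0
      simp only at hv
      rw [hall] at hv
      by_cases h1 : y ∈ X
      swap
      · rw [diagKernel_of_not_valid fun h => h1 (hv.mp h).1,
          rowKernel_of_not_valid h0 fun h => h1 h.1, rowKernel_of_not_valid h0' fun h => h1 h.1,
          sub_zero]
      by_cases h2 : RowRel marked y (l ⟨d - 1, hd1⟩)
      · rw [diagKernel_of_not_valid fun h => (hv.mp h).2.2 h2, rowKernel_of_valid h0 h1 (himp h2),
          rowKernel_of_valid h0' h1 h2, sub_zero]
      rw [rowKernel_of_not_valid h0' fun h => h2 h.2]
      by_cases h3 : RowRel marked y (l ⟨d, hd⟩)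
      · rw [diagKernel_of_valid h0 (hv.mpr ⟨h1, h3, h2⟩), rowKernel_of_valid h0 h1 h3, sub_self]
      · rw [diagKernel_of_not_valid fun h => h3 (hv.mp h).2.1,
          rowKernel_of_not_valid h0 fun h => h3 h.2, sub_self]
  have hall : ∀ d, ∑ k : Fin r → Y, (∏ i, F 0 i (k i)) * S k =
      ∑ k : Fin r → Y, (∏ i, F d i (k i)) * S k := by
    intro d
    induction d with
    | zero => rfl
    | succ d ih => rw [ih, hstep]
  have h1 : F 0 = fun i => diagKernel marked X w lam top i l := by
    funext i
    simp [hF]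
  have h2 : F r = fun i => rowKernel marked X w (lam i) (top i) (l i) := by
    funext i
    simp [hF]
  have := hall r
  rw [h1, h2] at this
  exact this.symm

/-- The generating function of a row of length `a` with first entry `k`. -/
noncomputable def rowGF (marked : Y → Prop) (X : Set Y) : (ℕ → Y → R) → ℕ → Y → Y → R
  | w, 0, t, k => rowKernel marked X (w 0) 0 t t k
  | w, a + 1, t, k =>
    ∑ l, rowKernel marked X (w 0) (a + 1) t l k * rowGF marked X (fun c => w (c + 1)) a t l

omit [NoZeroDivisors R] [CharZero R] in
theorem rowGF_eq_sum (marked : Y → Prop) (X : Set Y) (w : ℕ → Y → R) (a : ℕ) (t k : Y) :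
    rowGF marked X w a t k = ∑ l, rowKernel marked X (w 0) a t l k *
      rowGF marked X (fun c => w (c + 1)) (a - 1) t l := by
  cases a with
  | zero => simp [rowGF, rowKernel]
  | succ a => rfl

omit [Fintype Y] [NoZeroDivisors R] [CharZero R] in
theorem DiagValid.strictMono {marked : Y → Prop} {X : Set Y} {lam : Fin r → ℕ} {top : Fin r → Y}
    (hlam : ∀ i j, i < j → 0 < lam j → lam j < lam i)
    (htop : StrictMono top) (hX : ∀ x ∈ X, ∀ i, x < top i) {l k : Fin r → Y}
    (h : ∀ i, DiagValid marked X lam top i l (k i)) : StrictMono k := by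
  have hadj : ∀ j i : Fin r, (j : ℕ) + 1 = i → k j < k i := by
    intro j i hji
    have hlt : j < i := by rw [Fin.lt_def]; omega
    have hi := h i
    have hj := h j
    unfold DiagValid at hi hj
    by_cases hi0 : lam i = 0
    · rw [if_pos hi0] at hi
      by_cases hj0 : lam j = 0
      · rw [if_pos hj0] at hj
        rw [hi, hj]
        exact htop hlt
      · rw [if_neg hj0] at hj
        rw [hi]
        exact hX _ hj.1 i
    · have := hlam j i hlt (Nat.pos_of_ne_zero hi0)
      rw [if_neg hi0] at hi
      rw [if_neg (by omega)] at hj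
      exact lt_of_rowRel_of_not_rowRel hj.2.1 (hi.2.2 j hji)
  have : ∀ d : ℕ, ∀ j i : Fin r, (j : ℕ) + d + 1 = i → k j < k i := by
    intro d
    induction d with
    | zero => exact hadj
    | succ d ih =>
      intro j i hji
      exact (ih j ⟨j + d + 1, by omega⟩ rfl).trans (hadj _ _ (by simp only; omega))
  intro j i hji
  rw [Fin.lt_def] at hji
  exact this (i - j - 1) j i (by omega)

/-- Induction on the number of diagonals, with `S` general: summing out diagonal 0 against row
kernels gives a new function `S'` of diagonal 1. Antisymmetry is required only among unfinished
rows, since a finished row is tied to its own boundary letter. -/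
theorem sum_paths_eq_sum_rowGF (marked : Y → Prop) (X : Set Y) (top : Fin r → Y)
    (htop : StrictMono top) (hX : ∀ x ∈ X, ∀ i, x < top i) (n : ℕ) :
    ∀ (w : ℕ → Y → R) (lam : Fin r → ℕ), (∀ i, lam i ≤ n) →
    (∀ i j, i < j → 0 < lam j → lam j < lam i) →
    ∀ S : (Fin r → Y) → R,
    (∀ i j, i ≠ j → 0 < lam i → 0 < lam j → ∀ k, S (k ∘ Equiv.swap i j) = - S k) →
    ∑ T : Fin (n + 1) → Fin r → Y, (if T (Fin.last n) = top then
      (∏ c : Fin n, ∏ i, diagKernel marked X (w c) (fun i => lam i - c) top i (T c.succ)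
        (T c.castSucc i)) * S (T 0) else 0) =
      ∑ k : Fin r → Y, (∏ i, rowGF marked X w (lam i) (top i) (k i)) * S k := by
  induction n with
  | zero =>
    intro w lam hn hlam S hS
    have h0 : ∀ i, lam i = 0 := fun i => Nat.le_zero.mp (hn i)
    have h1 : ∀ k : Fin r → Y, ∏ i, rowGF marked X w (lam i) (top i) (k i) =
        if k = top then 1 else 0 := by
      intro k
      simp only [h0, rowGF, rowKernel, if_true]
      rw [Finset.prod_ite_zero]
      simp [funext_iff]
    simp_rw [h1]
    rw [← Equiv.sum_comp (Equiv.funUnique (Fin 1) (Fin r → Y)).symm]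
    refine Finset.sum_congr rfl fun k _ => ?_
    simp [Equiv.funUnique]
  | succ n ih =>
    intro w lam hn hlam S hS
    set S' : (Fin r → Y) → R := fun l =>
      ∑ k : Fin r → Y, (∏ i, rowKernel marked X (w 0) (lam i) (top i) (l i) (k i)) * S k with hS'
    -- For rows of positive length the row kernel does not depend on the row, so permuting such rows
    -- of `l` can be undone by permuting `k`.
    have hS'alt : ∀ i j, i ≠ j → 0 < lam i - 1 → 0 < lam j - 1 → ∀ k,
        S' (k ∘ Equiv.swap i j) = - S' k := by
      intro i j hij hi hj l
      simp only [hS']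
      rw [← Finset.sum_neg_distrib]
      refine (Equiv.sum_comp (Equiv.arrowCongr (Equiv.swap i j) (Equiv.refl Y)) _).symm.trans
        (Finset.sum_congr rfl fun k _ => ?_)
      have h1 : (Equiv.arrowCongr (Equiv.swap i j) (Equiv.refl Y)) k = k ∘ Equiv.swap i j := by
        funext m
        simp [Equiv.arrowCongr]
      rw [h1, hS i j hij (by omega) (by omega),
        ← Equiv.prod_comp (Equiv.swap i j)
          fun m => rowKernel marked X (w 0) (lam m) (top m) (l m) (k m), mul_neg]
      congr 2
      refine Finset.prod_congr rfl fun m _ => ?_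
      simp only [Function.comp_apply]
      have hi0 : lam i ≠ 0 := by omega
      have hj0 : lam j ≠ 0 := by omega
      by_cases hmi : m = i
      · subst hmi
        simp only [Equiv.swap_apply_left, rowKernel, hi0, hj0, if_false]
      by_cases hmj : m = j
      · subst hmj
        simp only [Equiv.swap_apply_right, rowKernel, hi0, hj0, if_false]
      rw [Equiv.swap_apply_of_ne_of_ne hmi hmj]
    have key := ih (fun c => w (c + 1)) (fun i => lam i - 1)
      (fun i => by have := hn i; omega)
      (fun i j hij h => by have := hlam i j hij (by omega); omega) S' hS'alt
    have hR : ∑ k : Fin r → Y, (∏ i, rowGF marked X w (lam i) (top i) (k i)) * S k =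
        ∑ l : Fin r → Y, (∏ i, rowGF marked X (fun c => w (c + 1)) (lam i - 1) (top i) (l i)) *
          S' l := by
      simp only [hS', Finset.mul_sum]
      rw [Finset.sum_comm]
      refine Finset.sum_congr rfl fun k _ => ?_
      simp_rw [← mul_assoc, ← Finset.prod_mul_distrib]
      rw [← Finset.sum_mul]
      congr 1
      rw [Finset.prod_congr rfl fun i _ => rowGF_eq_sum marked X w (lam i) (top i) (k i),
        Finset.prod_univ_sum, Fintype.piFinset_univ]
      exact Finset.sum_congr rfl fun l _ => Finset.prod_congr rfl fun i _ => mul_comm _ _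
    rw [hR, ← key, ← Equiv.sum_comp (Fin.consEquiv fun _ => Fin r → Y), Fintype.sum_prod_type,
      Finset.sum_comm]
    refine Finset.sum_congr rfl fun T _ => ?_
    have hlast : ∀ k : Fin r → Y, (Fin.cons k T : Fin (n + 2) → Fin r → Y) (Fin.last (n + 1)) =
        T (Fin.last n) := fun k => by
      rw [← Fin.succ_last, Fin.cons_succ]
    simp only [Fin.consEquiv_apply, hlast]
    by_cases hT : T (Fin.last n) = top
    swap
    · simp [hT]
    simp only [hT, if_true, Fin.prod_univ_succ (n := n), Fin.cons_succ, Fin.cons_zero,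
      Fin.castSucc_zero, ← Fin.succ_castSucc, Fin.val_zero, Fin.val_succ, Nat.sub_zero]
    have hsub : ∀ (c : Fin n) i, lam i - ((c : ℕ) + 1) = lam i - 1 - (c : ℕ) := fun c i => by omega
    simp only [hsub]
    set P := ∏ c : Fin n, ∏ i, diagKernel marked X (w (c + 1)) (fun i => lam i - 1 - c) top i
        (T c.succ) (T c.castSucc i) with hP
    -- If the rest of the path has nonzero weight, all its steps are valid, and diagonal 1 is
    -- strictly increasing as the removal of column conditions demands.
    by_cases hP0 : P = 0
    · simp [hP0]
    have hmono : StrictMono (T 0) := by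
      cases n with
      | zero =>
        have : T 0 = top := hT
        rw [this]
        exact htop
      | succ n =>
        rw [hP] at hP0
        have h1 := Finset.prod_ne_zero_iff.mp hP0 0 (Finset.mem_univ _)
        have h2 := fun i => Finset.prod_ne_zero_iff.mp h1 i (Finset.mem_univ _)
        refine DiagValid.strictMono (marked := marked) (X := X) (lam := fun i => lam i - 1 - 0)
          (top := top) (l := T (Fin.succ 0)) ?_ htop hX ?_
        · intro i j hij h
          have := hlam i j hij (by omega)
          omega
        · intro i
          by_contra hv
          exact h2 i (if_neg hv)
    have hcol := sum_rowKernel_eq_sum_diagKernel marked X (w 0) lam top hlam (T 0) hmono S hS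
    have hS'T : S' (T 0) = _ := hcol
    rw [hS'T, Finset.mul_sum]
    refine Finset.sum_congr rfl fun k _ => ?_
    ring

end Kernels

/-! ### Pfaffians and the sign of a word -/

section Pfaffian

variable {n : ℕ}

/-- The positions `0, …, 2 n - 1`, grouped into the consecutive pairs `2 i, 2 i + 1`. -/
def pairEquiv (n : ℕ) : Fin n × Bool ≃ Fin (2 * n) where
  toFun p := if p.2 then pairSnd p.1 else pairFst p.1
  invFun v := (⟨v / 2, by omega⟩, decide ((v : ℕ) % 2 = 1))
  left_inv := by
    rintro ⟨i, b⟩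
    cases b
    · refine Prod.ext (Fin.ext ?_) ?_ <;> simp [pairFst]
    · refine Prod.ext (Fin.ext ?_) ?_
      · simp [pairSnd]; omega
      · simp [pairSnd]
  right_inv := by
    intro v
    refine Fin.ext ?_
    by_cases h : (v : ℕ) % 2 = 1
    · simp [h, pairSnd]; omega
    · simp [h, pairFst]; omega

@[simp] theorem pairEquiv_false (i : Fin n) : pairEquiv n (i, false) = pairFst i := rfl

@[simp] theorem pairEquiv_true (i : Fin n) : pairEquiv n (i, true) = pairSnd i := rfl

theorem pairFst_injective : Function.Injective (pairFst : Fin n → Fin (2 * n)) := fun i j h =>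
  congrArg Prod.fst ((pairEquiv n).injective (a₁ := (i, false)) (a₂ := (j, false)) h)

theorem pairFst_ne_pairSnd (i j : Fin n) : pairFst i ≠ pairSnd j := fun h =>
  Bool.false_ne_true
    (congrArg Prod.snd ((pairEquiv n).injective (a₁ := (i, false)) (a₂ := (j, true)) h))

/-- Permutations of the pairs together with permutations within each pair. -/
abbrev PairPerm (n : ℕ) : Type := Equiv.Perm (Fin n) × (Fin n → Equiv.Perm Bool)

/-- The action of a `PairPerm` on positions. -/
def PairPerm.toPerm (q : PairPerm n) : Equiv.Perm (Fin (2 * n)) :=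
  (pairEquiv n).permCongr
    ((Equiv.prodCongrLeft fun _ : Bool => q.1) * (Equiv.prodCongrRight q.2 : Equiv.Perm _))

theorem PairPerm.toPerm_apply (q : PairPerm n) (i : Fin n) (b : Bool) :
    q.toPerm (pairEquiv n (i, b)) = pairEquiv n (q.1 i, q.2 i b) := by
  simp [PairPerm.toPerm, Equiv.permCongr_apply]

theorem PairPerm.sign_toPerm (q : PairPerm n) :
    Equiv.Perm.sign q.toPerm = ∏ i, Equiv.Perm.sign (q.2 i) := by
  rw [PairPerm.toPerm, Equiv.Perm.sign_permCongr, Equiv.Perm.sign_mul,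
    Equiv.Perm.sign_prodCongrRight, Equiv.Perm.sign_prodCongrLeft]
  simp

theorem mem_pfaffianPerms {π : Equiv.Perm (Fin (2 * n))} : π ∈ pfaffianPerms n ↔
    StrictMono (fun i => π (pairFst i)) ∧ ∀ i : Fin n, π (pairFst i) < π (pairSnd i) := by
  simp [pfaffianPerms, StrictMono]

theorem one_mem_pfaffianPerms : (1 : Equiv.Perm (Fin (2 * n))) ∈ pfaffianPerms n := by
  rw [mem_pfaffianPerms]
  constructor
  · intro i j h
    rw [Fin.lt_def] at h ⊢
    simp only [Equiv.Perm.coe_one, id, pairFst]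
    omega
  · intro i
    rw [Fin.lt_def]
    simp [pairFst, pairSnd]

theorem min_apply_toPerm {π : Equiv.Perm (Fin (2 * n))} (hπ : π ∈ pfaffianPerms n)
    (q : PairPerm n) (i : Fin n) :
    min ((π * q.toPerm) (pairFst i)) ((π * q.toPerm) (pairSnd i)) = π (pairFst (q.1 i)) := by
  rw [← pairEquiv_false, ← pairEquiv_true, Equiv.Perm.mul_apply, Equiv.Perm.mul_apply,
    q.toPerm_apply, q.toPerm_apply]
  have h := (mem_pfaffianPerms.mp hπ).2 (q.1 i)
  have hne : q.2 i false ≠ q.2 i true := fun h => Bool.false_ne_true ((q.2 i).injective h)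
  cases h0 : q.2 i false <;> cases h1 : q.2 i true
  · exact absurd (h0.trans h1.symm) hne
  · simpa using h.le
  · simpa using h.le
  · exact absurd (h0.trans h1.symm) hne

/-- With its converse `exists_pfaffianPerms_mul_toPerm`, this makes `pfaffianPerms` a transversal of
the left cosets of the hyperoctahedral group. The minima of the pairs determine the representative.
-/
theorem pfaffianPerms_mul_toPerm_injective {π π' : Equiv.Perm (Fin (2 * n))}
    (hπ : π ∈ pfaffianPerms n) (hπ' : π' ∈ pfaffianPerms n) {q q' : PairPerm n}
    (h : π * q.toPerm = π' * q'.toPerm) : π = π' ∧ q = q' := by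
  have hmin : ∀ i, π (pairFst (q.1 i)) = π' (pairFst (q'.1 i)) := fun i => by
    rw [← min_apply_toPerm hπ, ← min_apply_toPerm hπ', h]
  have hm := (mem_pfaffianPerms.mp hπ).1
  have hm' := (mem_pfaffianPerms.mp hπ').1
  have hfst : (fun i => π (pairFst i)) = fun i => π' (pairFst i) := by
    refine (StrictMono.range_inj hm hm').mp (Set.ext fun v => ⟨?_, ?_⟩)
    · rintro ⟨i, rfl⟩
      refine ⟨q'.1 (q.1.symm i), ?_⟩
      have := hmin (q.1.symm i)
      rw [Equiv.apply_symm_apply] at this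
      exact this.symm
    · rintro ⟨i, rfl⟩
      refine ⟨q.1 (q'.1.symm i), ?_⟩
      have := hmin (q'.1.symm i)
      rw [Equiv.apply_symm_apply] at this
      exact this
  have h1 : q.1 = q'.1 := by
    ext1 i
    exact hm.injective ((hmin i).trans (congrFun hfst _).symm)
  have happ : ∀ i b, π (pairEquiv n (q.1 i, q.2 i b)) = π' (pairEquiv n (q.1 i, q'.2 i b)) := by
    intro i b
    have := congrArg (fun σ : Equiv.Perm (Fin (2 * n)) => σ (pairEquiv n (i, b))) h
    simp only [Equiv.Perm.mul_apply, PairPerm.toPerm_apply] at this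
    rwa [← h1] at this
  have h2 : q.2 = q'.2 := by
    funext i
    ext1 b
    have ha := happ i b
    have hlt := (mem_pfaffianPerms.mp hπ).2 (q.1 i)
    have hlt' := (mem_pfaffianPerms.mp hπ').2 (q.1 i)
    have hf : π (pairFst (q.1 i)) = π' (pairFst (q.1 i)) := congrFun hfst (q.1 i)
    cases h3 : q.2 i b <;> cases h4 : q'.2 i b
    · rfl
    · rw [h3, h4, pairEquiv_false, pairEquiv_true, hf] at ha
      exact absurd ha hlt'.ne
    · rw [h3, h4, pairEquiv_false, pairEquiv_true, ← hf] at ha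
      exact absurd ha hlt.ne'
    · rfl
  have hq : q = q' := Prod.ext h1 h2
  subst hq
  exact ⟨mul_right_cancel h, rfl⟩

theorem exists_pfaffianPerms_mul_toPerm (π : Equiv.Perm (Fin (2 * n))) :
    ∃ π₀ ∈ pfaffianPerms n, ∃ q : PairPerm n, π₀ * q.toPerm = π := by
  set f : Fin n → Fin (2 * n) := fun i => min (π (pairFst i)) (π (pairSnd i)) with hf
  have hinj : Function.Injective f := by
    have hex : ∀ i, ∃ b, f i = π (pairEquiv n (i, b)) := fun i => by
      rcases min_choice (π (pairFst i)) (π (pairSnd i)) with h | h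
      · exact ⟨false, h⟩
      · exact ⟨true, h⟩
    intro i j hij
    obtain ⟨b, hb⟩ := hex i
    obtain ⟨b', hb'⟩ := hex j
    rw [hb, hb'] at hij
    exact congrArg Prod.fst ((pairEquiv n).injective (π.injective hij))
  set σ := Tuple.sort f
  have hmono : StrictMono (f ∘ σ) :=
    (Tuple.monotone_sort f).strictMono_of_injective (hinj.comp σ.injective)
  -- Pairs are sorted by their minima through `σ`, then each is flipped if it is decreasing.
  set ε : Fin n → Equiv.Perm Bool := fun i =>
    if π (pairFst (σ i)) < π (pairSnd (σ i)) then 1 else Equiv.swap false true with hε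
  have happ : ∀ i b, (π * PairPerm.toPerm (σ, ε)) (pairEquiv n (i, b)) =
      π (pairEquiv n (σ i, ε i b)) := fun i b => by
    rw [Equiv.Perm.mul_apply, PairPerm.toPerm_apply]
  have hlt : ∀ i, (π * PairPerm.toPerm (σ, ε)) (pairFst i) = f (σ i) ∧
      (π * PairPerm.toPerm (σ, ε)) (pairFst i) < (π * PairPerm.toPerm (σ, ε)) (pairSnd i) := by
    intro i
    rw [← pairEquiv_false, ← pairEquiv_true, happ, happ]
    by_cases h : π (pairFst (σ i)) < π (pairSnd (σ i))
    · simp [hε, hf, h, h.le]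
    · have h' : π (pairSnd (σ i)) < π (pairFst (σ i)) :=
        lt_of_le_of_ne (not_lt.mp h) fun h => pairFst_ne_pairSnd _ _ (π.injective h.symm)
      simp [hε, hf, h, h', h'.le]
  refine ⟨π * PairPerm.toPerm (σ, ε), mem_pfaffianPerms.mpr ⟨?_, fun i => (hlt i).2⟩,
    (σ⁻¹, fun i => (ε (σ⁻¹ i))⁻¹), ?_⟩
  · have : (fun i => (π * PairPerm.toPerm (σ, ε)) (pairFst i)) = f ∘ σ :=
      funext fun i => (hlt i).1
    rw [this]
    exact hmono
  · ext1 v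
    obtain ⟨⟨i, b⟩, rfl⟩ := (pairEquiv n).surjective v
    rw [Equiv.Perm.mul_apply, PairPerm.toPerm_apply, happ]
    simp

/-- The signed product over the pairs of a permutation that occurs in the pfaffian. -/
def pfaffianTerm {R : Type*} [CommRing R] (A : Matrix (Fin (2 * n)) (Fin (2 * n)) R)
    (π : Equiv.Perm (Fin (2 * n))) : R :=
  ((Equiv.Perm.sign π : ℤ) : R) * ∏ i : Fin n, A (π (pairFst i)) (π (pairSnd i))

variable {R : Type*} [CommRing R] {A : Matrix (Fin (2 * n)) (Fin (2 * n)) R}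

theorem pfaffianTerm_mul_toPerm (hA : ∀ i j, A i j = - A j i) (π : Equiv.Perm (Fin (2 * n)))
    (q : PairPerm n) : pfaffianTerm A (π * q.toPerm) = pfaffianTerm A π := by
  have h1 : ∀ i, A ((π * q.toPerm) (pairFst i)) ((π * q.toPerm) (pairSnd i)) =
      ((Equiv.Perm.sign (q.2 i) : ℤ) : R) *
        A (π (pairFst (q.1 i))) (π (pairSnd (q.1 i))) := by
    intro i
    rw [← pairEquiv_false, ← pairEquiv_true, Equiv.Perm.mul_apply, Equiv.Perm.mul_apply,
      q.toPerm_apply, q.toPerm_apply]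
    have hc : ∀ e : Equiv.Perm Bool, e = 1 ∨ e = Equiv.swap false true := by decide
    rcases hc (q.2 i) with h | h
    · simp [h]
    · rw [h, Equiv.swap_apply_left, Equiv.swap_apply_right, Equiv.Perm.sign_swap (by decide),
        hA]
      simp
  unfold pfaffianTerm
  rw [Finset.prod_congr rfl fun i _ => h1 i, Finset.prod_mul_distrib,
    Equiv.prod_comp q.1 fun i => A (π (pairFst i)) (π (pairSnd i)), Equiv.Perm.sign_mul,
    q.sign_toPerm]
  have h2 : ((∏ i, Equiv.Perm.sign (q.2 i) : ℤˣ) : ℤ) * ((∏ i, Equiv.Perm.sign (q.2 i) : ℤˣ) : ℤ)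
      = 1 := by
    rw [← Units.val_mul, Int.units_mul_self, Units.val_one]
  have h3 := congrArg (Int.cast : ℤ → R) h2
  push_cast at h3 ⊢
  rw [mul_mul_mul_comm, mul_assoc, ← mul_assoc (∏ i, (((Equiv.Perm.sign (q.2 i) : ℤˣ) : ℤ) : R)),
    h3, one_mul]

theorem sum_pfaffianTerm (hA : ∀ i j, A i j = - A j i) :
    ∑ π, pfaffianTerm A π = Fintype.card (PairPerm n) * pfaffian A := by
  have h : ∑ x ∈ pfaffianPerms n ×ˢ (Finset.univ : Finset (PairPerm n)), pfaffianTerm A x.1 =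
      ∑ π, pfaffianTerm A π := by
    refine Finset.sum_bij (fun x _ => x.1 * x.2.toPerm) (fun _ _ => Finset.mem_univ _) ?_ ?_ ?_
    · rintro ⟨π, q⟩ h ⟨π', q'⟩ h' heq
      rw [Finset.mem_product] at h h'
      obtain ⟨h1, h2⟩ := pfaffianPerms_mul_toPerm_injective h.1 h'.1 heq
      exact Prod.ext h1 h2
    · intro π _
      obtain ⟨π₀, h, q, hq⟩ := exists_pfaffianPerms_mul_toPerm π
      exact ⟨(π₀, q), Finset.mem_product.mpr ⟨h, Finset.mem_univ _⟩, hq⟩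
    · intro x _
      exact (pfaffianTerm_mul_toPerm hA _ _).symm
  rw [← h, Finset.sum_product]
  simp only [Finset.sum_const, Finset.card_univ, nsmul_eq_mul]
  rw [← Finset.mul_sum]
  rfl

/-- The sum over the whole symmetric group is a nonzero multiple of the pfaffian, and there left
translation by `τ` only contributes its sign. -/
theorem pfaffian_submatrix_perm [NoZeroDivisors R] [CharZero R] (hA : ∀ i j, A i j = - A j i)
    (τ : Equiv.Perm (Fin (2 * n))) :
    pfaffian (A.submatrix τ τ) = ((Equiv.Perm.sign τ : ℤ) : R) * pfaffian A := by
  have h0 : (Fintype.card (PairPerm n) : R) ≠ 0 := Nat.cast_ne_zero.mpr Fintype.card_ne_zero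
  refine mul_left_cancel₀ h0 ?_
  rw [← sum_pfaffianTerm (A := A.submatrix τ τ) fun i j => hA _ _, mul_left_comm,
    ← sum_pfaffianTerm hA, ← Equiv.sum_comp (Equiv.mulLeft τ) (pfaffianTerm A), Finset.mul_sum]
  refine Finset.sum_congr rfl fun π _ => ?_
  have h2 : ((Equiv.Perm.sign τ : ℤˣ) : ℤ) * ((Equiv.Perm.sign τ : ℤˣ) : ℤ) = 1 := by
    rw [← Units.val_mul, Int.units_mul_self, Units.val_one]
  have h3 := congrArg (Int.cast : ℤ → R) h2
  push_cast at h3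
  simp only [pfaffianTerm, Equiv.coe_mulLeft, Equiv.Perm.sign_mul, Matrix.submatrix_apply,
    Equiv.Perm.mul_apply, Units.val_mul, Int.cast_mul]
  rw [← mul_assoc, ← mul_assoc, h3, one_mul]

/-- The sign `+1` of an increasing pair, `-1` of a decreasing one. -/
def orderSign (R : Type*) [CommRing R] {Y : Type*} [LinearOrder Y] (x y : Y) : R :=
  if x < y then 1 else if y < x then -1 else 0

theorem orderSign_antisymm {Y : Type*} [LinearOrder Y] (x y : Y) :
    orderSign R x y = - orderSign R y x := by
  unfold orderSign
  rcases lt_trichotomy x y with h | h | h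
  · simp [h, h.not_gt]
  · simp [h]
  · simp [h, h.not_gt]

/-- The positions `2 i` and `2 i + 1` are images of the two positions of one pair. -/
def KeepsPair (π : Equiv.Perm (Fin (2 * n))) (i : Fin n) : Prop :=
  ((pairEquiv n).symm (π⁻¹ (pairFst i))).1 = ((pairEquiv n).symm (π⁻¹ (pairSnd i))).1

theorem exists_eq_toPerm_of_keepsPair {π : Equiv.Perm (Fin (2 * n))} (h : ∀ i, KeepsPair π i) :
    ∃ q : PairPerm n, q.toPerm = π := by
  set g : Fin n → Bool → Fin n := fun m b => ((pairEquiv n).symm (π (pairEquiv n (m, b)))).1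
    with hg
  set d : Fin n → Bool → Bool := fun m b => ((pairEquiv n).symm (π (pairEquiv n (m, b)))).2
    with hd
  have hgd : ∀ m b, π (pairEquiv n (m, b)) = pairEquiv n (g m b, d m b) := fun m b => by
    rw [← Equiv.symm_apply_eq]
  have hkeep : ∀ i b b', ((pairEquiv n).symm (π⁻¹ (pairEquiv n (i, b)))).1 =
      ((pairEquiv n).symm (π⁻¹ (pairEquiv n (i, b')))).1 := by
    intro i b b'
    cases b <;> cases b'
    · rfl
    · exact h i
    · exact (h i).symm
    · rfl
  have hgb : ∀ m, g m true = g m false := by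
    intro m
    have h1 := hgd m false
    have h2 : π⁻¹ (pairEquiv n (g m false, d m false)) = pairEquiv n (m, false) := by
      rw [← h1, Equiv.Perm.inv_def, Equiv.symm_apply_apply]
    -- The partner of the image of `(m, false)` comes from pair `m` too, hence from `(m, true)`.
    have h3 := hkeep (g m false) (d m false) (!(d m false))
    rw [h2, Equiv.symm_apply_apply] at h3
    obtain ⟨⟨m', b'⟩, h4⟩ := (pairEquiv n).surjective (π⁻¹ (pairEquiv n (g m false, !(d m false))))
    rw [← h4, Equiv.symm_apply_apply] at h3
    change m = m' at h3
    subst h3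
    have h5 : π (pairEquiv n (m, b')) = pairEquiv n (g m false, !(d m false)) := by
      rw [h4, Equiv.Perm.inv_def, Equiv.apply_symm_apply]
    cases b' with
    | false =>
      rw [h1] at h5
      have := congrArg Prod.snd ((pairEquiv n).injective h5)
      simp at this
    | true =>
      rw [hgd] at h5
      have h6 : (g m true, d m true) = (g m false, !(d m false)) := (pairEquiv n).injective h5
      exact (Prod.mk.inj h6).1
  have hgb' : ∀ m b, g m b = g m false := fun m b => by
    cases b
    · rfl
    · exact hgb m
  have hsurj : Function.Surjective fun m => g m false := by
    intro i
    obtain ⟨v, hv⟩ := π.surjective (pairEquiv n (i, false))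
    obtain ⟨⟨m, b⟩, rfl⟩ := (pairEquiv n).surjective v
    rw [hgd, hgb'] at hv
    exact ⟨m, congrArg Prod.fst ((pairEquiv n).injective hv)⟩
  have hinj : ∀ m, Function.Injective (d m) := by
    intro m b b' hb
    have : π (pairEquiv n (m, b)) = π (pairEquiv n (m, b')) := by
      rw [hgd, hgd, hgb' m b, hgb' m b', hb]
    exact congrArg Prod.snd ((pairEquiv n).injective (π.injective this))
  refine ⟨(Equiv.ofBijective _ (Finite.surjective_iff_bijective.mp hsurj),
    fun m => Equiv.ofBijective (d m) (Finite.injective_iff_bijective.mp (hinj m))), ?_⟩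
  ext1 v
  obtain ⟨⟨m, b⟩, rfl⟩ := (pairEquiv n).surjective v
  rw [PairPerm.toPerm_apply, hgd, hgb']
  rfl

theorem keepsPair_toPerm (q : PairPerm n) (i : Fin n) : KeepsPair q.toPerm i := by
  have h : ∀ b, q.toPerm⁻¹ (pairEquiv n (i, b)) =
      pairEquiv n (q.1⁻¹ i, (q.2 (q.1⁻¹ i))⁻¹ b) := fun b => by
    rw [Equiv.Perm.inv_eq_iff_eq, q.toPerm_apply]
    simp
  unfold KeepsPair
  rw [← pairEquiv_false, ← pairEquiv_true, h, h, Equiv.symm_apply_apply, Equiv.symm_apply_apply]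

theorem keepsPair_swap_mul (π : Equiv.Perm (Fin (2 * n))) (i j : Fin n) :
    KeepsPair (Equiv.swap (pairFst i) (pairSnd i) * π) j ↔ KeepsPair π j := by
  unfold KeepsPair
  simp only [mul_inv_rev, Equiv.swap_inv, Equiv.Perm.mul_apply]
  by_cases h : j = i
  · subst h
    rw [Equiv.swap_apply_left, Equiv.swap_apply_right]
    exact eq_comm
  · have h1 : pairFst j ≠ pairFst i := fun h' => h (pairFst_injective h')
    have h2 : pairSnd j ≠ pairSnd i := fun h' => h (congrArg Prod.fst
      ((pairEquiv n).injective (a₁ := (j, true)) (a₂ := (i, true)) h'))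
    rw [Equiv.swap_apply_of_ne_of_ne h1 (pairFst_ne_pairSnd _ _),
      Equiv.swap_apply_of_ne_of_ne (pairFst_ne_pairSnd _ _).symm h2]

/-- The two exchanged values are consecutive, so only their mutual comparison is affected. -/
theorem orderSign_swap (i : Fin n) {a b : Fin (2 * n)}
    (h1 : ¬ (a = pairFst i ∧ b = pairSnd i)) (h2 : ¬ (a = pairSnd i ∧ b = pairFst i)) :
    orderSign R (Equiv.swap (pairFst i) (pairSnd i) a) (Equiv.swap (pairFst i) (pairSnd i) b) =
      orderSign R a b := by
  have hlt : ∀ a b : Fin (2 * n), ¬ (a = pairFst i ∧ b = pairSnd i) →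
      ¬ (a = pairSnd i ∧ b = pairFst i) →
      (Equiv.swap (pairFst i) (pairSnd i) a < Equiv.swap (pairFst i) (pairSnd i) b ↔ a < b) := by
    intro a b h1 h2
    simp only [Equiv.swap_apply_def]
    split_ifs with h3 h4 h5 h6 h7 h8 h9 <;>
      simp only [Fin.ext_iff, Fin.lt_def, pairFst, pairSnd] at * <;> omega
  unfold orderSign
  simp only [hlt a b h1 h2, hlt b a (fun h => h2 h.symm) (fun h => h1 h.symm)]

theorem pfaffianTerm_orderSign_swap_mul {π : Equiv.Perm (Fin (2 * n))} {i : Fin n}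
    (h : ¬ KeepsPair π i) :
    pfaffianTerm (Matrix.of (orderSign R)) (Equiv.swap (pairFst i) (pairSnd i) * π) =
      - pfaffianTerm (Matrix.of (orderSign R)) π := by
  unfold pfaffianTerm
  rw [Equiv.Perm.sign_mul, Equiv.Perm.sign_swap (pairFst_ne_pairSnd i i)]
  have : ∀ m, orderSign R ((Equiv.swap (pairFst i) (pairSnd i) * π) (pairFst m))
      ((Equiv.swap (pairFst i) (pairSnd i) * π) (pairSnd m)) =
      orderSign R (π (pairFst m)) (π (pairSnd m)) := by
    intro m
    refine orderSign_swap i ?_ ?_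
    · rintro ⟨h1, h2⟩
      apply h
      unfold KeepsPair
      rw [← h1, ← h2, Equiv.Perm.inv_def, Equiv.symm_apply_apply, Equiv.symm_apply_apply, ← pairEquiv_false,
        ← pairEquiv_true, Equiv.symm_apply_apply, Equiv.symm_apply_apply]
    · rintro ⟨h1, h2⟩
      apply h
      unfold KeepsPair
      rw [← h1, ← h2, Equiv.Perm.inv_def, Equiv.symm_apply_apply, Equiv.symm_apply_apply, ← pairEquiv_false,
        ← pairEquiv_true, Equiv.symm_apply_apply, Equiv.symm_apply_apply]
  simp only [Matrix.of_apply, this]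
  simp

open Classical in
-- A sign-reversing involution: if the values `2 i` and `2 i + 1` lie in different pairs, exchanging
-- them negates the term. Only permutations preserving all pairs survive, each contributing 1.
theorem pfaffian_orderSign [NoZeroDivisors R] [CharZero R] :
    pfaffian (Matrix.of (orderSign R) : Matrix (Fin (2 * n)) (Fin (2 * n)) R) = 1 := by
  have h0 : (Fintype.card (PairPerm n) : R) ≠ 0 := Nat.cast_ne_zero.mpr Fintype.card_ne_zero
  have hanti : ∀ i j, (Matrix.of (orderSign R) : Matrix (Fin (2 * n)) (Fin (2 * n)) R) i j =
      - (Matrix.of (orderSign R) : Matrix (Fin (2 * n)) (Fin (2 * n)) R) j i :=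
    fun i j => orderSign_antisymm i j
  refine mul_left_cancel₀ h0 ?_
  rw [← sum_pfaffianTerm hanti, mul_one]
  set G : Equiv.Perm (Fin (2 * n)) → R := pfaffianTerm (Matrix.of (orderSign R)) with hG
  -- Pairs are treated one at a time; the discarded terms keep the first `d` pairs but not pair `d`,
  -- and cancel under the swap.
  have hstep : ∀ d : ℕ, ∑ π, (if ∀ i : Fin n, (i : ℕ) < d → KeepsPair π i then G π else 0) =
      ∑ π, (if ∀ i : Fin n, (i : ℕ) < d + 1 → KeepsPair π i then G π else 0) := by
    intro d
    by_cases hd : d < n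
    swap
    · have : ∀ i : Fin n, (i : ℕ) < d ↔ (i : ℕ) < d + 1 := fun i => by omega
      simp only [this]
    have hsplit : ∀ π : Equiv.Perm (Fin (2 * n)), (∀ i : Fin n, (i : ℕ) < d + 1 → KeepsPair π i) ↔
        (∀ i : Fin n, (i : ℕ) < d → KeepsPair π i) ∧ KeepsPair π ⟨d, hd⟩ := by
      intro π
      constructor
      · intro h
        exact ⟨fun i hi => h i (by omega), h _ (by simp)⟩
      · rintro ⟨h, h'⟩ i hi
        by_cases hid : (i : ℕ) = d
        · have : i = ⟨d, hd⟩ := Fin.ext hid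
          rwa [this]
        · exact h i (by omega)
    rw [← sub_eq_zero, ← Finset.sum_sub_distrib]
    set D : Equiv.Perm (Fin (2 * n)) → R := fun π =>
      (if ∀ i : Fin n, (i : ℕ) < d → KeepsPair π i then G π else 0) -
        (if ∀ i : Fin n, (i : ℕ) < d + 1 → KeepsPair π i then G π else 0) with hD
    have hDneg : ∀ π, D (Equiv.swap (pairFst ⟨d, hd⟩) (pairSnd ⟨d, hd⟩) * π) = - D π := by
      intro π
      simp only [hD, hsplit, keepsPair_swap_mul]
      by_cases h1 : ∀ i : Fin n, (i : ℕ) < d → KeepsPair π i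
      · by_cases h2 : KeepsPair π ⟨d, hd⟩
        · rw [if_pos h1, if_pos h1, if_pos ⟨h1, h2⟩, if_pos ⟨h1, h2⟩]
          simp
        · rw [if_pos h1, if_pos h1, if_neg fun h => h2 h.2, if_neg fun h => h2 h.2, hG,
            pfaffianTerm_orderSign_swap_mul h2]
          simp
      · rw [if_neg h1, if_neg h1, if_neg fun h => h1 h.1, if_neg fun h => h1 h.1]
        simp
    have hself : ∑ π, D π = - ∑ π, D π := by
      rw [← Finset.sum_neg_distrib]
      refine (Equiv.sum_comp (Equiv.mulLeft (Equiv.swap (pairFst ⟨d, hd⟩) (pairSnd ⟨d, hd⟩)))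
        _).symm.trans (Finset.sum_congr rfl fun π _ => hDneg π)
    exact self_eq_neg.mp hself
  have hall : ∀ d : ℕ, ∑ π, G π =
      ∑ π, (if ∀ i : Fin n, (i : ℕ) < d → KeepsPair π i then G π else 0) := by
    intro d
    induction d with
    | zero => simp
    | succ d ih => rw [ih, hstep]
  have hone : G 1 = 1 := by
    have : ∀ i : Fin n, orderSign R (pairFst i) (pairSnd i) = 1 := fun i =>
      if_pos ((mem_pfaffianPerms.mp one_mem_pfaffianPerms).2 i)
    simp [hG, pfaffianTerm, this]
  rw [hall n, ← Finset.sum_filter]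
  have hcard : ∑ _q : PairPerm n, (1 : R) = Fintype.card (PairPerm n) := by
    simp
  rw [← hcard]
  symm
  refine Finset.sum_bij (fun q _ => q.toPerm) ?_ ?_ ?_ ?_
  · intro q _
    exact Finset.mem_filter.mpr ⟨Finset.mem_univ _, fun i _ => keepsPair_toPerm q i⟩
  · intro q _ q' _ h
    exact (pfaffianPerms_mul_toPerm_injective one_mem_pfaffianPerms one_mem_pfaffianPerms
      (by rw [one_mul, one_mul]; exact h)).2
  · intro π hπ
    obtain ⟨q, hq⟩ := exists_eq_toPerm_of_keepsPair
      fun i => (Finset.mem_filter.mp hπ).2 i i.isLt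
    exact ⟨q, Finset.mem_univ _, hq⟩
  · intro q _
    have := pfaffianTerm_mul_toPerm hanti 1 q
    rw [one_mul] at this
    rw [hG, this]
    exact hone.symm

/-- The pfaffian expansion of the signs of all pairs of letters is the sign of the sorting
permutation: it is antisymmetric, with value `1` at increasing words. -/
theorem pfaffian_orderSign_comp_swap [NoZeroDivisors R] [CharZero R] {Y : Type*} [LinearOrder Y]
    (k : Fin (2 * n) → Y) {i j : Fin (2 * n)} (hij : i ≠ j) :
    pfaffian (Matrix.of fun a b => orderSign R ((k ∘ Equiv.swap i j) a) ((k ∘ Equiv.swap i j) b)) =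
      - pfaffian (Matrix.of fun a b => orderSign R (k a) (k b)) := by
  have := pfaffian_submatrix_perm (A := Matrix.of fun a b => orderSign R (k a) (k b))
    (fun i j => orderSign_antisymm _ _) (Equiv.swap i j)
  rw [Equiv.Perm.sign_swap hij] at this
  rw [Units.val_neg, Units.val_one, Int.cast_neg, Int.cast_one, neg_one_mul] at this
  exact this

theorem pfaffian_orderSign_of_strictMono [NoZeroDivisors R] [CharZero R] {Y : Type*}
    [LinearOrder Y] {k : Fin (2 * n) → Y} (hk : StrictMono k) :
    pfaffian (Matrix.of fun a b => orderSign R (k a) (k b)) = 1 := by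
  have : (Matrix.of fun a b => orderSign R (k a) (k b)) = Matrix.of (orderSign R) := by
    ext a b
    simp [orderSign, hk.lt_iff_lt]
  rw [this, pfaffian_orderSign]

theorem pfaffian_sum_eq {Y : Type*} [Fintype Y] [LinearOrder Y] (h : Fin (2 * n) → Y → R) :
    pfaffian (Matrix.of fun i j => ∑ x, ∑ y, h i x * h j y * orderSign R x y) =
      ∑ k : Fin (2 * n) → Y, (∏ i, h i (k i)) *
        pfaffian (Matrix.of fun a b => orderSign R (k a) (k b)) := by
  unfold pfaffian
  simp_rw [Finset.mul_sum]
  rw [Finset.sum_comm]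
  refine Finset.sum_congr rfl fun π _ => ?_
  simp_rw [mul_left_comm _ (((Equiv.Perm.sign π : ℤˣ) : ℤ) : R), ← Finset.mul_sum]
  congr 1
  simp only [Matrix.of_apply]
  simp_rw [← Fintype.sum_prod_type']
  rw [Finset.prod_univ_sum, Fintype.piFinset_univ]
  set e : Fin n × Bool ≃ Fin (2 * n) := (pairEquiv n).trans π with he
  -- Regroups a word into the pairs of letters matched by `π`.
  set E : (Fin (2 * n) → Y) ≃ (Fin n → Y × Y) :=
    ((Equiv.arrowCongr e.symm (Equiv.refl Y)).trans (Equiv.curry _ _ _)).trans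
      (Equiv.arrowCongr (Equiv.refl (Fin n)) (Equiv.boolArrowEquivProd Y)) with hE
  have hEk : ∀ k p, E k p = (k (π (pairFst p)), k (π (pairSnd p))) := fun k p => rfl
  rw [← Equiv.sum_comp E]
  refine Finset.sum_congr rfl fun k _ => ?_
  rw [← Equiv.prod_comp e fun i => h i (k i), Fintype.prod_prod_type, ← Finset.prod_mul_distrib]
  refine Finset.prod_congr rfl fun p _ => ?_
  rw [hEk, Fintype.prod_bool]
  simp only [he, Equiv.trans_apply, pairEquiv_true, pairEquiv_false]
  ring

theorem pfaffian_congr {B : Matrix (Fin (2 * n)) (Fin (2 * n)) R}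
    (h : ∀ i j, i < j → A i j = B i j) : pfaffian A = pfaffian B := by
  unfold pfaffian
  refine Finset.sum_congr rfl fun π hπ => ?_
  congr 1
  exact Finset.prod_congr rfl fun i _ => h _ _ ((mem_pfaffianPerms.mp hπ).2 i)

end Pfaffian

/-! ### Tableaux with bounded entries as paths of diagonals -/

section Tableaux

variable {r : ℕ} {lam : Fin r → ℕ}

/-- Both adjacency relations are transitive, and strictness of the shape puts all intermediate boxes
of a column into the diagram. -/
theorem isQSST_iff (hlam : StrictAnti lam) (m : ShiftedTableau lam MarkedLetter) :
    IsQSST m ↔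
      (∀ i c (h : c < lam i) (h' : c + 1 < lam i), RowRel MarkedLetter.IsMarked
        (m ⟨i, ⟨c, h⟩⟩) (m ⟨i, ⟨c + 1, h'⟩⟩)) ∧
      ∀ i j : Fin r, (j : ℕ) + 1 = i → ∀ c (h : c < lam i) (h' : c + 1 < lam j),
        ¬ RowRel MarkedLetter.IsMarked (m ⟨i, ⟨c, h⟩⟩) (m ⟨j, ⟨c + 1, h'⟩⟩) := by
  constructor
  · intro hm
    refine ⟨fun i c h h' => ?_, fun i j hji c h h' => ?_⟩
    · rcases (hm.row_weak ⟨i, ⟨c, h⟩⟩ ⟨i, ⟨c + 1, h'⟩⟩ rfl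
        (by simp [ShiftedBox.col])).lt_or_eq with h1 | h1
      · exact Or.inl h1
      · refine Or.inr ⟨h1, fun h2 => ?_⟩
        have := hm.marked_row ⟨i, ⟨c, h⟩⟩ ⟨i, ⟨c + 1, h'⟩⟩ rfl h1 h2
        simp at this
    · have hcol : ShiftedBox.col (⟨j, ⟨c + 1, h'⟩⟩ : ShiftedBox lam) =
          ShiftedBox.col (⟨i, ⟨c, h⟩⟩ : ShiftedBox lam) := by
        simp only [ShiftedBox.col]; omega
      rw [not_rowRel_iff]
      rcases (hm.col_weak ⟨j, ⟨c + 1, h'⟩⟩ ⟨i, ⟨c, h⟩⟩ hcol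
        (by simp only [ShiftedBox.row]; omega)).lt_or_eq with h1 | h1
      · exact Or.inl h1
      · refine Or.inr ⟨h1, by_contra fun h2 => ?_⟩
        have := congrArg ShiftedBox.row (hm.unmarked_col _ _ hcol h1 h2)
        simp only [ShiftedBox.row] at this
        omega
  · rintro ⟨hrow, hcol⟩
    have hrow' : ∀ d i c c' (h : c < lam i) (h' : c' < lam i), c' = c + d + 1 →
        RowRel MarkedLetter.IsMarked (m ⟨i, ⟨c, h⟩⟩) (m ⟨i, ⟨c', h'⟩⟩) := by
      intro d
      induction d with
      | zero =>
        rintro i c c' h h' rfl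
        exact hrow i c h h'
      | succ d ih =>
        rintro i c c' h h' rfl
        exact (ih i c (c + d + 1) h (by omega) rfl).trans (hrow i (c + d + 1) (by omega) h')
    have hcol' : ∀ d (i j : Fin r), (j : ℕ) + d + 1 = i → ∀ c c' (h : c < lam i) (h' : c' < lam j),
        c' = c + d + 1 →
        ¬ RowRel MarkedLetter.IsMarked (m ⟨i, ⟨c, h⟩⟩) (m ⟨j, ⟨c', h'⟩⟩) := by
      intro d
      induction d with
      | zero =>
        rintro i j hji c c' h h' rfl
        exact hcol i j hji c h h'
      | succ d ih =>
        rintro i j hji c c' h h' rfl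
        have hi : (j : ℕ) + d + 1 < r := by omega
        have hlt : (⟨(j : ℕ) + d + 1, hi⟩ : Fin r) < i := by rw [Fin.lt_def]; simp only; omega
        have h1 := hlam hlt
        exact not_rowRel_trans
          (ih ⟨(j : ℕ) + d + 1, hi⟩ j rfl (c + 1) (c + (d + 1) + 1) (by omega) h' (by omega))
          (hcol i ⟨(j : ℕ) + d + 1, hi⟩ (by simp only; omega) c h (by omega))
    have hrel : ∀ b b' : ShiftedBox lam, b.row = b'.row → b.col < b'.col →
        RowRel MarkedLetter.IsMarked (m b) (m b') := by
      rintro ⟨i, c, h⟩ ⟨i', c', h'⟩ hr hc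
      obtain rfl : i = i' := Fin.ext hr
      simp only [ShiftedBox.col] at hc
      exact hrow' (c' - c - 1) i c c' h h' (by omega)
    have hcrel : ∀ b b' : ShiftedBox lam, b.col = b'.col → b.row < b'.row →
        ¬ RowRel MarkedLetter.IsMarked (m b') (m b) := by
      rintro ⟨i, c, h⟩ ⟨i', c', h'⟩ hc hr
      simp only [ShiftedBox.col, ShiftedBox.row] at hc hr
      exact hcol' ((i' : ℕ) - i - 1) i' i (by omega) c' c h' h (by omega)
    have hext : ∀ b b' : ShiftedBox lam, b.row = b'.row → b.col = b'.col → b = b' := by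
      rintro ⟨i, c, h⟩ ⟨i', c', h'⟩ hr hc
      obtain rfl : i = i' := Fin.ext hr
      simp only [ShiftedBox.col] at hc
      obtain rfl : c = c' := by omega
      rfl
    refine ⟨fun b b' hr hc => ?_, fun b b' hc hr => ?_, fun b b' hr he hm => ?_,
      fun b b' hc he hm => ?_⟩
    · rcases hc.lt_or_eq with h | h
      · exact (hrel b b' hr h).le
      · rw [hext b b' hr h]
    · rcases hr.lt_or_eq with h | h
      · exact (not_rowRel_iff.mp (hcrel b b' hc h)).elim (fun h => h.le) fun h => h.1.le
      · rw [hext b b' h hc]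
    · rcases lt_trichotomy b.col b'.col with h | h | h
      · exact (hrel b b' hr h).elim (fun h => absurd he h.ne) fun h => absurd hm h.2
      · exact hext b b' hr h
      · exact (hrel b' b hr.symm h).elim (fun h => absurd he h.ne')
          fun h => absurd (he ▸ hm) h.2
    · rcases lt_trichotomy b.row b'.row with h | h | h
      · exact (not_rowRel_iff.mp (hcrel b b' hc h)).elim (fun h => absurd he h.ne)
          fun h => absurd h.2 hm
      · exact hext b b' h hc
      · exact (not_rowRel_iff.mp (hcrel b' b hc.symm h)).elim (fun h => absurd he h.ne')
          fun h => absurd (he ▸ h.2) hm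

/-- The marked letters of absolute value at most `M`. -/
abbrev LetterLE (M : ℕ) : Type := {x : MarkedLetter // x.abs ≤ M}

noncomputable instance LetterLE.fintype (M : ℕ) : Fintype (LetterLE M) :=
  Fintype.ofInjective
    (fun x => ((⟨x.1.abs, Nat.lt_succ_of_le x.2⟩ : Fin (M + 1)), (ofLex x.1).2)) (by
      rintro ⟨x, hx⟩ ⟨y, hy⟩ h
      have h1 : x.abs = y.abs := congrArg (fun p => (p.1 : ℕ)) h
      have h2 : (ofLex x).2 = (ofLex y).2 := congrArg (fun p => p.2) h
      exact Subtype.ext (ofLex.injective (Prod.ext (PNat.eq h1) h2)))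

theorem finite_setOf_abs_le (lam : Fin r → ℕ) (N : ℕ) :
    {m : QSST lam | ∀ b, (m.1 b).abs ≤ N}.Finite := by
  refine Set.Finite.of_injOn (f := fun m => m.1)
    (t := Set.range fun (t : ShiftedBox lam → LetterLE N) b => (t b).1) ?_
    Subtype.val_injective.injOn (Set.finite_range _)
  intro m hm
  exact ⟨fun b => ⟨m.1 b, hm b⟩, rfl⟩

/-- The tableaux in `QSST lam` whose entries have absolute value at most `N`. -/
noncomputable def boundedQSST (lam : Fin r → ℕ) (N : ℕ) : Finset (QSST lam) :=
  (finite_setOf_abs_le lam N).toFinset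

theorem mem_boundedQSST {N : ℕ} {m : QSST lam} :
    m ∈ boundedQSST lam N ↔ ∀ b, (m.1 b).abs ≤ N := by
  simp [boundedQSST]

open Classical in
/-- The sequence of the diagonals of a tableau, where finished rows are filled up by boundary
letters. -/
noncomputable def diagonals {M : ℕ} (n : ℕ) (top : Fin r → LetterLE M)
    (m : ShiftedTableau lam MarkedLetter) (c : Fin (n + 1)) (i : Fin r) : LetterLE M :=
  if h : ∃ hc : (c : ℕ) < lam i, (m ⟨i, ⟨c, hc⟩⟩).abs ≤ M then ⟨m ⟨i, ⟨c, h.1⟩⟩, h.2⟩ else top i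

theorem diagonals_of_lt {M n : ℕ} {top : Fin r → LetterLE M}
    {m : ShiftedTableau lam MarkedLetter} {c : Fin (n + 1)} {i : Fin r} (hc : (c : ℕ) < lam i)
    (hM : (m ⟨i, ⟨c, hc⟩⟩).abs ≤ M) : diagonals n top m c i = ⟨m ⟨i, ⟨c, hc⟩⟩, hM⟩ :=
  dif_pos ⟨hc, hM⟩

theorem diagonals_of_le {M n : ℕ} {top : Fin r → LetterLE M}
    {m : ShiftedTableau lam MarkedLetter} {c : Fin (n + 1)} {i : Fin r} (hc : lam i ≤ c) :
    diagonals n top m c i = top i :=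
  dif_neg fun h => absurd h.1 (not_lt.mpr hc)

theorem prod_box_eq {R : Type*} [CommRing R] {n : ℕ} (hn : ∀ i, lam i ≤ n)
    (f : ShiftedBox lam → R) : ∏ b, f b = ∏ c : Fin n, ∏ i,
      if h : (c : ℕ) < lam i then f ⟨i, ⟨c, h⟩⟩ else 1 := by
  rw [Fintype.prod_sigma, Finset.prod_comm]
  refine Finset.prod_congr rfl fun i _ => ?_
  rw [Fin.prod_univ_eq_prod_range (fun c => if h : c < lam i then f ⟨i, ⟨c, h⟩⟩ else 1) n,
    ← Finset.prod_subset (Finset.range_mono (hn i)), ← Fin.prod_univ_eq_prod_range]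
  · refine Finset.prod_congr rfl fun c _ => ?_
    rw [dif_pos c.isLt]
  · intro c _ hc
    exact dif_neg fun h => hc (Finset.mem_range.mpr h)

theorem diagValid_diagonals (hlam : StrictAnti lam) {N M n : ℕ} (hNM : N ≤ M)
    {top : Fin r → LetterLE M} (hX : ∀ x : LetterLE M, x.1.abs ≤ N → ∀ i, x < top i)
    {m : QSST lam} (hm : m ∈ boundedQSST lam N) (c : Fin n) (i : Fin r) :
    DiagValid (fun y : LetterLE M => y.1.IsMarked) {y | y.1.abs ≤ N} (fun i => lam i - c) top i
      (diagonals n top m.1 c.succ) (diagonals n top m.1 c.castSucc i) := by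
  have hb := mem_boundedQSST.mp hm
  obtain ⟨hrow, hcol⟩ := (isQSST_iff hlam m.1).mp m.2
  unfold DiagValid
  by_cases h0 : lam i - c = 0
  · rw [if_pos h0]
    exact diagonals_of_le (by simp only [Fin.val_castSucc]; omega)
  rw [if_neg h0]
  have hc : ((c.castSucc : Fin (n + 1)) : ℕ) < lam i := by simp only [Fin.val_castSucc]; omega
  have hbc := hb ⟨i, ⟨_, hc⟩⟩
  rw [diagonals_of_lt hc (hbc.trans hNM)]
  refine ⟨hbc, ?_, fun j hji => ?_⟩
  · by_cases h1 : ((c.succ : Fin (n + 1)) : ℕ) < lam i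
    · rw [diagonals_of_lt h1 ((hb _).trans hNM)]
      have := hrow i c hc h1
      rcases this with h | ⟨h, h'⟩
      · exact Or.inl h
      · exact Or.inr ⟨Subtype.ext h, h'⟩
    · rw [diagonals_of_le (not_lt.mp h1)]
      exact Or.inl (hX _ hbc i)
  · have hlt := hlam (show j < i by rw [Fin.lt_def]; omega)
    have h1 : ((c.succ : Fin (n + 1)) : ℕ) < lam j := by
      simp only [Fin.val_succ]; omega
    rw [diagonals_of_lt h1 ((hb _).trans hNM)]
    intro h
    refine hcol i j hji c hc h1 ?_
    rcases h with h | ⟨h, h'⟩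
    · exact Or.inl h
    · exact Or.inr ⟨congrArg Subtype.val h, h'⟩

theorem exists_diagonals_eq (hlam : StrictAnti lam) {N M n : ℕ} (hn : ∀ i, lam i ≤ n)
    {top : Fin r → LetterLE M} {T : Fin (n + 1) → Fin r → LetterLE M}
    (hlast : T (Fin.last n) = top)
    (hT : ∀ (c : Fin n) i, DiagValid (fun y : LetterLE M => y.1.IsMarked) {y | y.1.abs ≤ N}
      (fun i => lam i - c) top i (T c.succ) (T c.castSucc i)) :
    ∃ m ∈ boundedQSST lam N, diagonals n top m.1 = T := by
  have hlt : ∀ {i c}, c < lam i → c < n + 1 := fun {i c} h => by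
    have := hn i
    omega
  set m : ShiftedTableau lam MarkedLetter := fun b => (T ⟨b.2, hlt b.2.isLt⟩ b.1).1 with hm
  have hv : ∀ i c (h : c < lam i), T ⟨c, hlt h⟩ i ∈ {y : LetterLE M | y.1.abs ≤ N} ∧
      RowRel (fun y : LetterLE M => y.1.IsMarked) (T ⟨c, hlt h⟩ i)
        (T ⟨c + 1, by have := hn i; omega⟩ i) ∧
      ∀ j : Fin r, (j : ℕ) + 1 = i → ¬ RowRel (fun y : LetterLE M => y.1.IsMarked)
        (T ⟨c, hlt h⟩ i) (T ⟨c + 1, by have := hn i; omega⟩ j) := by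
    intro i c h
    have := hT ⟨c, by have := hn i; omega⟩ i
    unfold DiagValid at this
    rw [if_neg (by simp only; omega)] at this
    exact this
  have hq : IsQSST m := by
    rw [isQSST_iff hlam]
    constructor
    · intro i c h h'
      rcases (hv i c h).2.1 with h1 | ⟨h1, h2⟩
      · exact Or.inl h1
      · exact Or.inr ⟨congrArg Subtype.val h1, h2⟩
    · intro i j hji c h h' hR
      refine (hv i c h).2.2 j hji ?_
      rcases hR with h1 | ⟨h1, h2⟩
      · exact Or.inl h1
      · exact Or.inr ⟨Subtype.ext h1, h2⟩
  refine ⟨⟨m, hq⟩, mem_boundedQSST.mpr fun b => (hv b.1 b.2 b.2.isLt).1, ?_⟩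
  funext c i
  by_cases hc : (c : ℕ) < lam i
  · rw [diagonals_of_lt hc (T c i).2]
  · rw [diagonals_of_le (not_lt.mp hc)]
    induction c using Fin.lastCases with
    | last => rw [hlast]
    | cast c =>
      have := hT c i
      unfold DiagValid at this
      rw [if_pos (show lam i - (c : ℕ) = 0 by simp only [Fin.val_castSucc] at hc; omega)] at this
      exact this.symm

variable {R : Type*} [CommRing R] [NoZeroDivisors R] [CharZero R]

/-- The bounded tableau sum in terms of row generating functions and an antisymmetric function. -/
theorem sum_boundedQSST_eq (hlam : StrictAnti lam) {N M : ℕ} (hNM : N ≤ M)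
    {top : Fin r → LetterLE M} (htop : StrictMono top)
    (hX : ∀ x : LetterLE M, x.1.abs ≤ N → ∀ i, x < top i) (w : ℕ → MarkedLetter → R)
    (S : (Fin r → LetterLE M) → R)
    (hS : ∀ i j, i ≠ j → ∀ k, S (k ∘ Equiv.swap i j) = - S k)
    (hS1 : ∀ k, StrictMono k → S k = 1) :
    ∑ m ∈ boundedQSST lam N, ∏ b, w b.2 (m.1 b) =
      ∑ k : Fin r → LetterLE M, (∏ i, rowGF (fun y : LetterLE M => y.1.IsMarked)
        {y | y.1.abs ≤ N} (fun c y => w c y.1) (lam i) (top i) (k i)) * S k := by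
  obtain ⟨n, hn⟩ : ∃ n, ∀ i, lam i ≤ n :=
    ⟨∑ i, lam i, fun i => Finset.single_le_sum (fun _ _ => Nat.zero_le _) (Finset.mem_univ i)⟩
  refine Eq.trans ?_ (sum_paths_eq_sum_rowGF _ {y : LetterLE M | y.1.abs ≤ N} top htop hX n
    (fun c y => w c y.1) lam hn (fun i j hij _ => hlam hij) S fun i j hij _ _ => hS i j hij)
  refine Finset.sum_of_injOn (fun m => diagonals n top m.1) ?_ (fun _ _ => Finset.mem_univ _)
    ?_ ?_
  · intro m hm m' hm' h
    refine Subtype.ext (funext fun b => ?_)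
    have hb := mem_boundedQSST.mp hm b
    have hb' := mem_boundedQSST.mp hm' b
    have hc : ((⟨b.2, by have := hn b.1; omega⟩ : Fin (n + 1)) : ℕ) < lam b.1 := b.2.isLt
    have h1 := congrFun (congrFun h ⟨b.2, by have := hn b.1; omega⟩) b.1
    simp only at h1
    rw [diagonals_of_lt hc (hb.trans hNM), diagonals_of_lt hc (hb'.trans hNM)] at h1
    exact congrArg Subtype.val h1
  · intro T _ hT
    by_contra hne
    by_cases hlast : T (Fin.last n) = top
    swap
    · exact hne (if_neg hlast)
    rw [if_pos hlast] at hne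
    have h1 := left_ne_zero_of_mul hne
    obtain ⟨m, hm, h⟩ := exists_diagonals_eq (N := N) hlam hn hlast fun c i => by
      by_contra hv
      exact h1 (Finset.prod_eq_zero (Finset.mem_univ c)
        (Finset.prod_eq_zero (Finset.mem_univ i) (if_neg hv)))
    exact hT ⟨m, hm, h⟩
  · intro m hm
    have hlast : diagonals n top m.1 (Fin.last n) = top :=
      funext fun i => diagonals_of_le (hn i)
    have hv := diagValid_diagonals (n := n) hlam hNM hX hm
    have hmono : StrictMono (diagonals n top m.1 0) := by
      cases n with
      | zero =>
        rw [← hlast] at htop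
        exact htop
      | succ n =>
        exact DiagValid.strictMono (lam := fun i => lam i - 0) (fun i j hij _ => hlam hij) htop hX
          (hv 0)
    rw [if_pos hlast, hS1 _ hmono, mul_one, prod_box_eq hn]
    refine Finset.prod_congr rfl fun c _ => Finset.prod_congr rfl fun i _ => ?_
    unfold diagKernel
    rw [if_pos (hv c i)]
    by_cases hc : (c : ℕ) < lam i
    · rw [dif_pos hc, if_neg (show ¬ lam i - (c : ℕ) = 0 by omega), diagonals_of_lt (c := c.castSucc) hc
        ((mem_boundedQSST.mp hm _).trans hNM)]
      rfl
    · rw [dif_neg hc, if_pos (show lam i - (c : ℕ) = 0 by omega)]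

theorem sum_boundedQSST_eq_pfaffian {n : ℕ} {lam : Fin (2 * n) → ℕ} (hlam : StrictAnti lam)
    (N : ℕ) (w : ℕ → MarkedLetter → R) :
    ∑ m ∈ boundedQSST lam N, ∏ b, w b.2 (m.1 b) =
      pfaffian (Matrix.of fun i j =>
        ∑ m ∈ boundedQSST (lam ∘ ![i, j]) N, ∏ b, w b.2 (m.1 b)) := by
  -- Room for one boundary letter `N + i + 1` per row above the entries, in a finite alphabet.
  set M := N + 2 * n with hM
  set top : Fin (2 * n) → LetterLE M := fun i =>
    ⟨toLex ((⟨N + i + 1, Nat.succ_pos _⟩ : ℕ+), true), by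
      simp only [MarkedLetter.abs, ofLex_toLex, PNat.mk_coe]; omega⟩ with htop
  have hmono : StrictMono top := by
    intro i j hij
    refine Prod.Lex.lt_iff.mpr (Or.inl ?_)
    rw [Fin.lt_def] at hij
    rw [← PNat.coe_lt_coe]
    simp only [htop, ofLex_toLex, PNat.mk_coe]
    omega
  have hX : ∀ x : LetterLE M, x.1.abs ≤ N → ∀ i, x < top i := by
    intro x hx i
    refine Prod.Lex.lt_iff.mpr (Or.inl ?_)
    rw [← PNat.coe_lt_coe]
    simp only [MarkedLetter.abs] at hx
    simp only [htop, ofLex_toLex, PNat.mk_coe]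
    omega
  rw [sum_boundedQSST_eq hlam (by omega) hmono hX w
    (fun k => pfaffian (Matrix.of fun a b => orderSign R (k a) (k b)))
    (fun i j hij k => pfaffian_orderSign_comp_swap k hij)
    (fun k hk => pfaffian_orderSign_of_strictMono hk), ← pfaffian_sum_eq]
  refine pfaffian_congr fun i j hij => ?_
  have hpair : StrictMono ![i, j] := by
    intro a b hab
    fin_cases a <;> fin_cases b <;> simp_all
  simp only [Matrix.of_apply]
  -- The two-row case keeps the alphabet and the boundary letters, so its row generating functions
  -- are those of the full shape.
  rw [sum_boundedQSST_eq (hlam.comp_strictMono hpair) (M := M) (top := top ∘ ![i, j]) (by omega)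
    (hmono.comp hpair) (fun x hx a => hX x hx _) w (fun k => orderSign R (k 0) (k 1)) ?_ ?_]
  · rw [← Equiv.sum_comp (finTwoArrowEquiv (LetterLE M)).symm, Fintype.sum_prod_type]
    refine Finset.sum_congr rfl fun x _ => Finset.sum_congr rfl fun y _ => ?_
    simp [Fin.prod_univ_two, finTwoArrowEquiv]
  · intro a b hab k
    have : (Equiv.swap a b : Equiv.Perm (Fin 2)) = Equiv.swap 0 1 := by
      revert hab
      revert a b
      decide
    rw [this]
    simp only [Function.comp_apply, Equiv.swap_apply_left, Equiv.swap_apply_right]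
    exact orderSign_antisymm _ _
  · intro k hk
    exact if_pos (hk (by decide))

end Tableaux

/-! ### Passage to the limit -/

section Convergence

open Filter Topology

theorem MarkedLetter.abs_mono {x y : MarkedLetter} (h : x ≤ y) : x.abs ≤ y.abs := by
  rcases Prod.Lex.le_iff.mp h with h | h
  · exact (PNat.coe_lt_coe _ _).mpr h |>.le
  · exact (congrArg PNat.val h.1).le

theorem MarkedLetter.one_le_abs (x : MarkedLetter) : 1 ≤ x.abs := (ofLex x).1.pos

variable {r : ℕ} {lam : Fin r → ℕ}

theorem tendsto_boundedQSST : Tendsto (boundedQSST lam) atTop atTop := by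
  refine tendsto_atTop_finset_of_monotone ?_ ?_
  · intro N N' h m hm
    exact mem_boundedQSST.mpr fun b => (mem_boundedQSST.mp hm b).trans h
  · intro m
    exact ⟨∑ b, (m.1 b).abs, mem_boundedQSST.mpr fun b =>
      Finset.single_le_sum (f := fun b => (m.1 b).abs) (fun _ _ => Nat.zero_le _)
        (Finset.mem_univ b)⟩

theorem summable_of_bddAbove_boundedQSST {f : QSST lam → ℝ} (hf : ∀ m, 0 ≤ f m)
    (h : BddAbove (Set.range fun N => ∑ m ∈ boundedQSST lam N, f m)) : Summable f := by
  obtain ⟨C, hC⟩ := h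
  refine summable_of_sum_le hf (c := C) fun u => ?_
  obtain ⟨N, hN⟩ := (tendsto_boundedQSST.eventually_ge_atTop u).exists
  exact (Finset.sum_le_sum_of_subset_of_nonneg hN fun m _ _ => hf m).trans (hC ⟨N, rfl⟩)

/-- Entries above the diagonal suffice, as the pfaffian reads no others. -/
theorem tendsto_pfaffian {n : ℕ} {R : Type*} [CommRing R] [TopologicalSpace R]
    [IsTopologicalRing R] {A : ℕ → Matrix (Fin (2 * n)) (Fin (2 * n)) R}
    {B : Matrix (Fin (2 * n)) (Fin (2 * n)) R}
    (h : ∀ i j, i < j → Tendsto (fun N => A N i j) atTop (𝓝 (B i j))) :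
    Tendsto (fun N => pfaffian (A N)) atTop (𝓝 (pfaffian B)) := by
  unfold pfaffian
  refine tendsto_finsetSum _ fun π hπ => Tendsto.const_mul _ ?_
  exact tendsto_finsetProd _ fun i _ => h _ _ ((mem_pfaffianPerms.mp hπ).2 i)

/-- The weight `1 / |x| ^ a` of a single box. -/
noncomputable def letterWeight (a : ℂ) (x : MarkedLetter) : ℂ := ((x.abs : ℂ) ^ a)⁻¹

theorem schurQTerm_eq_prod (s : ShiftedTableau lam ℂ) (m : QSST lam) :
    schurQTerm s m = ∏ b, letterWeight (s b) (m.1 b) := by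
  simp [schurQTerm, letterWeight, Finset.prod_inv_distrib]

theorem norm_letterWeight (a : ℂ) (x : MarkedLetter) :
    ‖letterWeight a x‖ = (x.abs : ℝ) ^ (-a.re) := by
  have h : 0 < x.abs := x.one_le_abs
  rw [letterWeight, norm_inv, Complex.norm_natCast_cpow_of_pos h,
    Real.rpow_neg (Nat.cast_nonneg _)]

theorem ShiftedTableau.IsDiag.exists_eq {s : ShiftedTableau lam ℂ} (hlam : StrictAnti lam)
    (hs : s.IsDiag) : ∃ a : ℕ → ℂ, ∀ b, s b = a b.2 := by
  classical
  refine ⟨fun c => if h : ∃ b : ShiftedBox lam, b.row = 0 ∧ (b.2 : ℕ) = c then s h.choose else 0,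
    fun b => ?_⟩
  have hr : 0 < r := Nat.zero_lt_of_lt b.1.isLt
  have h : ∃ b₁ : ShiftedBox lam, b₁.row = 0 ∧ (b₁.2 : ℕ) = b.2 :=
    ⟨⟨⟨0, hr⟩, ⟨b.2, b.2.isLt.trans_le (hlam.antitone (Fin.le_def.mpr (Nat.zero_le _)))⟩⟩, rfl, rfl⟩
  simp only
  rw [dif_pos h]
  have key : ∀ b₁ : ShiftedBox lam, b₁.row = 0 → (b₁.2 : ℕ) = b.2 → s b = s b₁ := by
    intro b₁ h₁ h₂
    refine hs b b₁ h₁ ?_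
    simp only [ShiftedBox.col, ShiftedBox.row]
    omega
  exact key _ h.choose_spec.1 h.choose_spec.2

theorem summable_and_schurQZeta_eq {n : ℕ} {lam : Fin (2 * n) → ℕ} (hlam : StrictAnti lam)
    {s : ShiftedTableau lam ℂ} (hs : s.IsDiag)
    (h : ∀ i j : Fin (2 * n), i < j → Summable (schurQTerm (s.twoRows i j))) :
    Summable (schurQTerm s) ∧ schurQZeta s = pfaffian (schurQMatrix s) := by
  obtain ⟨a, ha⟩ := hs.exists_eq hlam
  have hterm : ∀ m, schurQTerm s m = ∏ b, letterWeight (a b.2) (m.1 b) := fun m => by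
    rw [schurQTerm_eq_prod]
    exact Finset.prod_congr rfl fun b _ => by rw [ha]
  have hterm2 : ∀ i j m, schurQTerm (s.twoRows i j) m =
      ∏ b, letterWeight (a b.2) (m.1 b) := fun i j m => by
    rw [schurQTerm_eq_prod]
    exact Finset.prod_congr rfl fun b _ => by
      rw [show s.twoRows i j b = a b.2 from ha ⟨![i, j] b.1, b.2⟩]
  have hnorm : ∀ m, ‖schurQTerm s m‖ = ∏ b, ‖letterWeight (a b.2) (m.1 b)‖ := fun m => by
    rw [hterm, norm_prod]
  have hsum : Summable (schurQTerm s) := by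
    refine Summable.of_norm (summable_of_bddAbove_boundedQSST (fun _ => norm_nonneg _) ?_)
    -- The finite identity for the real weights `‖·‖`: the pfaffian has signs, but it converges with
    -- its entries and is therefore bounded in `N`.
    simp_rw [hnorm, sum_boundedQSST_eq_pfaffian hlam _ fun c x => ‖letterWeight (a c) x‖]
    refine (tendsto_pfaffian (B := Matrix.of fun i j => ∑' m, ‖schurQTerm (s.twoRows i j) m‖)
      fun i j hij => ?_).bddAbove_range
    refine ((h i j hij).norm.hasSum.comp tendsto_boundedQSST).congr fun N => ?_
    exact Finset.sum_congr rfl fun m _ => by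
      simp only [hterm2, norm_prod]
  refine ⟨hsum, tendsto_nhds_unique (hsum.hasSum.comp tendsto_boundedQSST) ?_⟩
  have hfin : ∀ N, ∑ m ∈ boundedQSST lam N, schurQTerm s m = pfaffian (Matrix.of fun i j =>
      ∑ m ∈ boundedQSST (lam ∘ ![i, j]) N, ∏ b, letterWeight (a b.2) (m.1 b)) := fun N => by
    simp_rw [hterm, sum_boundedQSST_eq_pfaffian hlam N fun c x => letterWeight (a c) x]
  refine (tendsto_pfaffian (B := schurQMatrix s) fun i j hij => ?_).congr fun N => (hfin N).symm
  have hentry : schurQMatrix s i j = schurQZeta (s.twoRows i j) := by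
    simp [schurQMatrix, hij]
  rw [hentry]
  refine ((h i j hij).hasSum.comp tendsto_boundedQSST).congr fun N => ?_
  exact Finset.sum_congr rfl fun m _ => hterm2 i j m

/-! ### Absolute convergence from the conditions on the exponents -/

theorem summable_abs_rpow {p : ℝ} (hp : 1 < p) :
    Summable fun x : MarkedLetter => (x.abs : ℝ) ^ (-p) := by
  rw [← (toLex : ℕ+ × Bool ≃ MarkedLetter).summable_iff]
  refine (summable_prod_of_nonneg fun x => Real.rpow_nonneg (Nat.cast_nonneg _) _).mpr
    ⟨fun _ => Summable.of_finite, ?_⟩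
  have h : Summable fun k : ℕ+ => ((k : ℕ) : ℝ) ^ (-p) :=
    (Real.summable_nat_rpow.mpr (by linarith)).comp_injective PNat.coe_injective
  refine (h.mul_left 2).congr fun k => ?_
  rw [tsum_bool]
  simp [MarkedLetter.abs, two_mul]

theorem summable_prod_pi {ι X : Type*} [Fintype ι] {g : ι → X → ℝ} (hg0 : ∀ i x, 0 ≤ g i x)
    (hg : ∀ i, Summable (g i)) : Summable fun t : ι → X => ∏ i, g i (t i) := by
  classical
  refine summable_of_sum_le (fun t => Finset.prod_nonneg fun i _ => hg0 i _)
    (c := ∏ i, ∑' x, g i x) fun u => ?_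
  calc ∑ t ∈ u, ∏ i, g i (t i)
      ≤ ∑ t ∈ Fintype.piFinset fun i => u.image fun t => t i, ∏ i, g i (t i) := by
        refine Finset.sum_le_sum_of_subset_of_nonneg ?_
          fun t _ _ => Finset.prod_nonneg fun i _ => hg0 i _
        intro t ht
        exact Fintype.mem_piFinset.mpr fun i => Finset.mem_image_of_mem _ ht
    _ = ∏ i, ∑ x ∈ u.image fun t => t i, g i x := (Finset.prod_univ_sum _ _).symm
    _ ≤ ∏ i, ∑' x, g i x := Finset.prod_le_prod
        (fun i _ => Finset.sum_nonneg fun x _ => hg0 i x)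
        fun i _ => (hg i).sum_le_tsum _ fun x _ => hg0 i x

/-- The last entry is the largest, so its surplus factor of exponent `-ε` splits into `l` equal
parts, each bounded by the same power of another entry. -/
theorem prod_rpow_neg_le {l : ℕ} (hl : 0 < l) {x σ : Fin l → ℝ} (hx : ∀ c, 1 ≤ x c)
    (hxl : ∀ c, x c ≤ x ⟨l - 1, Nat.sub_one_lt_of_lt hl⟩) (hσ : ∀ c, 1 ≤ σ c) {ε : ℝ}
    (hε : 0 ≤ ε) (hσl : σ ⟨l - 1, Nat.sub_one_lt_of_lt hl⟩ = 1 + ε) :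
    ∏ c, x c ^ (-σ c) ≤ ∏ c, x c ^ (-(1 + ε / l)) := by
  obtain ⟨k, rfl⟩ : ∃ k, l = k + 1 := ⟨l - 1, by omega⟩
  change ∀ c, x c ≤ x (Fin.last k) at hxl
  change σ (Fin.last k) = 1 + ε at hσl
  have hpos : ∀ c, 0 < x c := fun c => zero_lt_one.trans_le (hx c)
  have hy := hpos (Fin.last k)
  have hδ : 0 ≤ ε / ((k + 1 : ℕ) : ℝ) := by positivity
  calc ∏ c, x c ^ (-σ c)
      = (∏ c : Fin k, x c.castSucc ^ (-σ c.castSucc)) * x (Fin.last k) ^ (-(1 + ε)) := by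
        rw [Fin.prod_univ_castSucc, hσl]
    _ ≤ (∏ c : Fin k, x c.castSucc ^ (-1 : ℝ)) * x (Fin.last k) ^ (-(1 + ε)) := by
        refine mul_le_mul_of_nonneg_right (Finset.prod_le_prod
          (fun c _ => Real.rpow_nonneg (hpos _).le _) fun c _ => ?_) (Real.rpow_nonneg hy.le _)
        exact Real.rpow_le_rpow_of_exponent_le (hx _) (neg_le_neg (hσ _))
    _ = ∏ c, x c ^ (-1 : ℝ) * x (Fin.last k) ^ (-(ε / ((k + 1 : ℕ) : ℝ))) := by
        rw [Finset.prod_mul_distrib, Fin.prod_univ_castSucc, mul_assoc, Finset.prod_const,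
          Finset.card_univ, Fintype.card_fin, ← Real.rpow_mul_natCast hy.le,
          ← Real.rpow_add hy]
        congr 2
        field_simp
        ring
    _ ≤ ∏ c, x c ^ (-(1 + ε / ((k + 1 : ℕ) : ℝ))) := by
        refine Finset.prod_le_prod (fun c _ => mul_nonneg (Real.rpow_nonneg (hpos _).le _)
          (Real.rpow_nonneg hy.le _)) fun c _ => ?_
        rw [neg_add, Real.rpow_add (hpos c)]
        exact mul_le_mul_of_nonneg_left
          (Real.rpow_le_rpow_of_nonpos (hpos c) (hxl c) (neg_nonpos.mpr hδ))
          (Real.rpow_nonneg (hpos c).le _)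

theorem exists_exponent_row {s : ShiftedTableau lam ℂ} (h1 : ∀ b, 1 ≤ (s b).re)
    (h2 : ∀ b : ShiftedBox lam, (b.2 : ℕ) + 1 = lam b.1 → 1 < (s b).re) (i : Fin r) :
    ∃ p : ℝ, 1 < p ∧ ∀ m : QSST lam,
      ∏ c : Fin (lam i), ((m.1 ⟨i, c⟩).abs : ℝ) ^ (-(s ⟨i, c⟩).re) ≤
        ∏ c : Fin (lam i), ((m.1 ⟨i, c⟩).abs : ℝ) ^ (-p) := by
  rcases Nat.eq_zero_or_pos (lam i) with h0 | hl
  -- An empty row imposes nothing; any exponent above 1 would do.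
  · refine ⟨2, one_lt_two, fun m => ?_⟩
    have : IsEmpty (Fin (lam i)) := by rw [h0]; infer_instance
    simp
  set last : Fin (lam i) := ⟨lam i - 1, Nat.sub_one_lt_of_lt hl⟩ with hlast
  have hε := h2 ⟨i, last⟩ (by simp only [hlast]; omega)
  have hl' : (0 : ℝ) < lam i := Nat.cast_pos.mpr hl
  refine ⟨1 + ((s ⟨i, last⟩).re - 1) / lam i,
    lt_add_of_pos_right _ (div_pos (by linarith) hl'), fun m => ?_⟩
  refine prod_rpow_neg_le (x := fun c => ((m.1 ⟨i, c⟩).abs : ℝ)) (σ := fun c => (s ⟨i, c⟩).re)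
    hl (fun c => Nat.one_le_cast.mpr (MarkedLetter.one_le_abs _)) (fun c => ?_)
    (fun c => h1 _) (by linarith) (add_sub_cancel _ _).symm
  refine Nat.cast_le.mpr (MarkedLetter.abs_mono (m.2.row_weak ⟨i, c⟩ ⟨i, last⟩ rfl ?_))
  simp only [ShiftedBox.col, hlast]
  omega

theorem summable_prod_abs_rpow {p : Fin r → ℝ} (hp : ∀ i, 1 < p i) :
    Summable fun t : ShiftedBox lam → MarkedLetter => ∏ b, ((t b).abs : ℝ) ^ (-(p b.1)) :=
  summable_prod_pi (ι := ShiftedBox lam) (g := fun b (x : MarkedLetter) => (x.abs : ℝ) ^ (-(p b.1)))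
    (fun _ _ => Real.rpow_nonneg (Nat.cast_nonneg _) _) fun b => summable_abs_rpow (hp b.1)

theorem norm_schurQTerm_le {s : ShiftedTableau lam ℂ} {p : Fin r → ℝ} {m : QSST lam}
    (h : ∀ i, ∏ c : Fin (lam i), ((m.1 ⟨i, c⟩).abs : ℝ) ^ (-(s ⟨i, c⟩).re) ≤
      ∏ c : Fin (lam i), ((m.1 ⟨i, c⟩).abs : ℝ) ^ (-(p i))) :
    ‖schurQTerm s m‖ ≤ ∏ b, ((m.1 b).abs : ℝ) ^ (-(p b.1)) := by
  rw [schurQTerm_eq_prod, norm_prod, Finset.prod_congr rfl fun b _ => norm_letterWeight _ _,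
    Fintype.prod_sigma, Fintype.prod_sigma]
  exact Finset.prod_le_prod
    (fun i _ => Finset.prod_nonneg fun c _ => Real.rpow_nonneg (Nat.cast_nonneg _) _)
    fun i _ => h i

/-- Once every exponent exceeds 1, the tableau conditions can be forgotten and the sum taken over
all fillings. -/
theorem summable_schurQTerm {s : ShiftedTableau lam ℂ} (h1 : ∀ b, 1 ≤ (s b).re)
    (h2 : ∀ b : ShiftedBox lam, (b.2 : ℕ) + 1 = lam b.1 → 1 < (s b).re) :
    Summable (schurQTerm s) := by
  choose p hp hle using exists_exponent_row h1 h2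
  exact Summable.of_norm_bounded
    ((summable_prod_abs_rpow (lam := lam) hp).comp_injective Subtype.val_injective)
    fun m => norm_schurQTerm_le fun i => hle i m

end Convergence

theorem mainTheorem1 (n : ℕ) (lam : Fin (2 * n) → ℕ) (hlam : StrictAnti lam)
    (s : ShiftedTableau lam ℂ) (hs : s.IsDiag) :
    ((∀ b : ShiftedBox lam, 1 ≤ (s b).re ∧ ((b.2 : ℕ) + 1 = lam b.1 → 1 < (s b).re)) →
      ∀ i j : Fin (2 * n), i < j → Summable (schurQTerm (s.twoRows i j))) ∧
    ((∀ i j : Fin (2 * n), i < j → Summable (schurQTerm (s.twoRows i j))) →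
      Summable (schurQTerm s) ∧ schurQZeta s = pfaffian (schurQMatrix s)) := by
  refine ⟨fun h i j _ => ?_, summable_and_schurQZeta_eq hlam hs⟩
  exact summable_schurQTerm (fun b => (h ⟨![i, j] b.1, b.2⟩).1)
    fun b hb => (h ⟨![i, j] b.1, b.2⟩).2 hb
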